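/- **Conventions.** Let $X$ be a (small) topological space. A *prestack* $\mathcal{G}$ on $X$ is a normalized pseudofunctor from $(\mathrm{Open}\,X)^{\mathrm{op}}$ to the $2$-category of categories (with small sets of morphisms); it consists of categories $\mathcal{G}(U)$ for $U\subset X$ open, restriction functors $i\mapsto i|_V$ for $V\subset U$, and composition isomorphisms. Morphisms and $2$-morphisms of prestacks are the pseudonatural transformations and the modifications. A morphism is an *equivalence* if it has an inverse up to $2$-isomorphism. A *gerbe* on $X$ is a stack of groupoids on $X$ that is locally nonempty and locally connected; a morphism of gerbes is a morphism of the underlying prestacks. For $i,j\in\mathrm{Ob}\,\mathcal{G}(U)$, $\mathcal{G}(i,j)$ denotes the sheaf $V\mapsto \mathrm{Hom}_{\mathcal{G}(V)}(i|_V,j|_V)$ on $U$. A *normal subgroupoid* $\mathcal{N}$ of a gerbe $\mathcal{G}$ is a collection of subgroupoids $\mathcal{N}(U)\subset\mathcal{G}(U)$, stable under restriction, such that each $\mathcal{N}(U)$ has the same objects as $\mathcal{G}(U)$, satisfies $\mathcal{N}(U)(i,j)=\emptyset$ for $i\neq j$ and $g\circ\mathcal{N}(U)(i,i)\circ g^{-1}=\mathcal{N}(U)(j,j)$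 for all $g\in\mathcal{G}(U)(i,j)$, and such that for each local object $i$ the presheaf of groups $\mathcal{N}(i,i)\subset\mathcal{G}(i,i)$ is a sheaf. The *kernel* $\mathrm{Ker}(F)$ of a morphism of gerbes $F:\mathcal{G}\to\mathcal{H}$ is the normal subgroupoid with $\mathrm{Ker}(F)(U)(i,i)=\mathrm{Ker}\bigl(F:\mathcal{G}(U)(i,i)\to\mathcal{H}(U)(F(i),F(i))\bigr)$. The morphism $F$ is a *weak epimorphism* if every object of $\mathcal{H}(U)$ is locally isomorphic to an object of the form $F(i)$ with $i$ a local object of $\mathcal{G}$, and all the maps of sheaves $\mathcal{G}(i,j)\to\mathcal{H}(F(i),F(j))$ are surjective. An *extension of gerbes* $1\to\mathcal{N}\to\mathcal{G}\xrightarrow{F}\mathcal{H}\to1$ consists of gerbes $\mathcal{G},\mathcal{H}$, a weak epimorphism $F$, and $\mathcal{N}=\mathrm{Ker}(F)$. A *morphism of extensions* $(D,E)$ from it to $1\to\mathcal{N}'\to\mathcal{G}'\xrightarrow{F'}\mathcal{H}'\to1$ consists of morphisms of gerbes $D:\mathcal{G}\to\mathcal{G}'$ and $E:\mathcal{H}\to\mathcal{H}'$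 such that $D(\mathcal{N})\subset\mathcal{N}'$ and $E\circ F$ is $2$-isomorphic to $F'\circ D$. **Theorem.** Let $\mathcal{G}$ be a gerbe on $X$, and let $\mathcal{N}$ be a normal subgroupoid of $\mathcal{G}$. Then there exist a gerbe $\mathcal{G}/\mathcal{N}$ and a morphism of gerbes $F:\mathcal{G}\to\mathcal{G}/\mathcal{N}$ with the following properties. (i) $1\to\mathcal{N}\to\mathcal{G}\xrightarrow{F}\mathcal{G}/\mathcal{N}\to1$ is an extension of gerbes. (ii) Let $1\to\mathcal{N}'\to\mathcal{G}'\xrightarrow{F'}\mathcal{H}'\to1$ be an extension of gerbes, and let $D:\mathcal{G}\to\mathcal{G}'$ be a morphism of gerbes such that $D(\mathcal{N})\subset\mathcal{N}'$. Then there is a morphism of gerbes $E:\mathcal{G}/\mathcal{N}\to\mathcal{H}'$, unique up to $2$-isomorphism, such that $(D,E)$ is a morphism of extensions from $1\to\mathcal{N}\to\mathcal{G}\xrightarrow{F}\mathcal{G}/\mathcal{N}\to1$ to $1\to\mathcal{N}'\to\mathcal{G}'\xrightarrow{F'}\mathcal{H}'\to1$. (iii) In the situation of (ii), assume that $D$ is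 an equivalence and that the sheaf homomorphisms $D:\mathcal{N}(i,i)\to\mathcal{N}'(D(i),D(i))$ are isomorphisms for all local objects $i$ of $\mathcal{G}$. Then $E$ is also an equivalence. -/

import Mathlib

open CategoryTheory Opposite TopologicalSpace Bicategory
open scoped CategoryTheory.Pseudofunctor.StrongTrans

universe w v u

namespace GerbeExtension

/-! ### Prestacks on a topological space -/

section Prestacks

/-- A prestack on `X`: a normalized pseudofunctor from the opposite of the category of
open sets of `X` to the 2-category of categories. -/
abbrev Prestack (X : Type w) [TopologicalSpace X] :=
  StrictlyUnitaryPseudofunctor (LocallyDiscrete (Opens X)ᵒᵖ) Cat.{v, u}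

variable {X : Type w} [TopologicalSpace X]

/-- The category `G(U)`. -/
abbrev Prestack.Sec (G : Prestack.{w, v, u} X) (U : Opens X) : Type u :=
  G.obj (.mk (op U))

/-- The restriction functor `G(U) ⥤ G(V)` for an inclusion `V ⊆ U`. -/
abbrev Prestack.res (G : Prestack.{w, v, u} X) {U V : Opens X} (h : V ≤ U) :
    G.Sec U ⥤ G.Sec V :=
  (G.map (homOfLE h).op.toLoc).toFunctor

/-- A morphism of prestacks: a 1-morphism (strong transformation) of pseudofunctors.
Two such morphisms `D`, `E` are 2-isomorphic when `Nonempty (D ≅ E)`, the isomorphism being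
taken in the category whose morphisms are the 2-morphisms (modifications). -/
abbrev PrestackHom (G H : Prestack.{w, v, u} X) :=
  G.toPseudofunctor ⟶ H.toPseudofunctor

/-- The functor `F(U) : G(U) ⥤ H(U)`. -/
abbrev PrestackHom.on {G H : Prestack.{w, v, u} X} (F : PrestackHom G H) (U : Opens X) :
    G.Sec U ⥤ H.Sec U :=
  (F.app (.mk (op U))).toFunctor

/-- The comparison isomorphism `ψ : F(i|_V) ⟶ F(i)|_V` of a morphism of prestacks. -/
abbrev PrestackHom.psi {G H : Prestack.{w, v, u} X} (F : PrestackHom G H) {U V : Opens X}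
    (h : V ≤ U) (i : G.Sec U) :
    (F.on V).obj ((G.res h).obj i) ⟶ (H.res h).obj ((F.on U).obj i) :=
  (F.naturality (homOfLE h).op.toLoc).hom.toNatTrans.app i

/-- Equivalences in the 2-category of prestacks. -/
def PrestackHom.IsEquivalence {G H : Prestack.{w, v, u} X} (F : PrestackHom G H) : Prop :=
  ∃ E : PrestackHom H G,
    Nonempty (F ≫ E ≅ 𝟙 G.toPseudofunctor) ∧ Nonempty (E ≫ F ≅ 𝟙 H.toPseudofunctor)

end Prestacks

/-! ### Gerbes -/

/-- A gerbe on `X`: a stack of groupoids that is locally nonempty and locally connected. -/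
structure Gerbe (X : Type w) [TopologicalSpace X] where
  /-- the underlying prestack -/
  toPrestack : Prestack.{w, v, u} X
  isStack : toPrestack.toPseudofunctor.IsStack (Opens.grothendieckTopology X)
  isGroupoid : ∀ U : Opens X, IsGroupoid (toPrestack.Sec U)
  locally_nonempty : ∀ x : X, ∃ U : Opens X, x ∈ U ∧ Nonempty (toPrestack.Sec U)
  locally_connected : ∀ (U : Opens X) (i j : toPrestack.Sec U) (x : X), x ∈ U →
    ∃ (V : Opens X) (h : V ≤ U), x ∈ V ∧
      Nonempty ((toPrestack.res h).obj i ⟶ (toPrestack.res h).obj j)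

section Gerbes

variable {X : Type w} [TopologicalSpace X]

/-- The groupoid `G(U)`. -/
abbrev Gerbe.Sec (G : Gerbe.{w, v, u} X) (U : Opens X) : Type u := G.toPrestack.Sec U

/-- The restriction functor `G(U) ⥤ G(V)` for an inclusion `V ⊆ U`. -/
abbrev Gerbe.res (G : Gerbe.{w, v, u} X) {U V : Opens X} (h : V ≤ U) : G.Sec U ⥤ G.Sec V :=
  G.toPrestack.res h

/-- The groupoid structure on `G(U)`; it has the same underlying category. -/
noncomputable instance Gerbe.groupoidSec (G : Gerbe.{w, v, u} X) (U : Opens X) :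
    Groupoid (G.Sec U) :=
  haveI := G.isGroupoid U
  Groupoid.ofIsGroupoid

/-- A morphism of gerbes is a morphism of the underlying prestacks. -/
abbrev GerbeHom (G H : Gerbe.{w, v, u} X) := PrestackHom G.toPrestack H.toPrestack

/-! ### Normal subgroupoids -/

/-- Normal subgroupoids of a groupoid: wide, stable under conjugation by all morphisms, and
totally disconnected. -/
structure IsNormalSubgroupoid {C : Type u} [Groupoid.{v} C] (N : Subgroupoid C) : Prop where
  isNormal : N.IsNormal
  totally_disconnected : ∀ i j : C, (N.arrows i j).Nonempty → i = j

/-- A normal subgroupoid of a gerbe `G`: a family of normal subgroupoids `N(U) ⊆ G(U)`, compatible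
with restriction, such that for every local object `i` the presheaf of groups
`N(i, i) ⊆ G(i, i)` is a sheaf. As `G(i, i)` is a sheaf, the last condition says that an
automorphism that belongs to `N` locally belongs to `N`. -/
structure NormalSubgroupoid (G : Gerbe.{w, v, u} X) where
  /-- the normal subgroupoid `N(U)` of `G(U)` -/
  on (U : Opens X) : Subgroupoid (G.Sec U)
  isNormal (U : Opens X) : IsNormalSubgroupoid (on U)
  res_mem {U V : Opens X} (h : V ≤ U) (i : G.Sec U) (a : i ⟶ i) :
    a ∈ (on U).arrows i i → (G.res h).map a ∈ (on V).arrows ((G.res h).obj i) ((G.res h).obj i)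
  isSheaf (U : Opens X) (i : G.Sec U) (a : i ⟶ i) :
    (∀ x ∈ U, ∃ (V : Opens X) (h : V ≤ U), x ∈ V ∧
      (G.res h).map a ∈ (on V).arrows ((G.res h).obj i) ((G.res h).obj i)) →
    a ∈ (on U).arrows i i

/-- The kernel of a functor `F` from a groupoid: the totally disconnected subgroupoid whose
automorphism group at `i` is the kernel of `F : Aut i → Aut (F i)`.
(For `i = j` the condition reads `F.map f = 𝟙`; for `i ≠ j` there are no arrows.) -/
def kernel {C : Type u} [Groupoid.{v} C] {D : Type u} [Category.{v} D] (F : C ⥤ D) :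
    Subgroupoid C where
  arrows i j := {f | ∃ h : i = j, F.map f = F.map (eqToHom h)}
  inv := by
    rintro i j p ⟨rfl, hp⟩
    exact ⟨rfl, by simp_all [Groupoid.inv_eq_inv]⟩
  mul := by
    rintro i j k p ⟨rfl, hp⟩ q ⟨rfl, hq⟩
    exact ⟨rfl, by simp_all⟩

/-- Sanity check: the automorphisms in the kernel are those that `F` sends to the identity. -/
theorem mem_kernel_iff {C : Type u} [Groupoid.{v} C] {D : Type u} [Category.{v} D] (F : C ⥤ D)
    {i : C} (a : i ⟶ i) : a ∈ (kernel F).arrows i i ↔ F.map a = 𝟙 (F.obj i) := by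
  simp [kernel]

/-! ### Extensions of gerbes -/

/-- Weak epimorphisms of gerbes. -/
structure IsWeakEpi {G H : Gerbe.{w, v, u} X} (F : GerbeHom G H) : Prop where
  /-- `F` is locally essentially surjective on objects. -/
  locally_surj_obj : ∀ (U : Opens X) (j : H.Sec U) (x : X), x ∈ U →
    ∃ (V : Opens X) (h : V ≤ U) (i : G.Sec V), x ∈ V ∧
      Nonempty ((F.on V).obj i ≅ (H.res h).obj j)
  /-- The maps of sheaves `G(i, j) → H(F(i), F(j))` are surjective, i.e. every section of the
  target lifts locally; the commutative square says that `g` maps to the restriction of `f`. -/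
  surj_iso : ∀ (U : Opens X) (i j : G.Sec U) (f : (F.on U).obj i ⟶ (F.on U).obj j) (x : X),
    x ∈ U → ∃ (V : Opens X) (h : V ≤ U) (g : (G.res h).obj i ⟶ (G.res h).obj j), x ∈ V ∧
      (F.on V).map g ≫ F.psi h j = F.psi h i ≫ (H.res h).map f

/-- `1 → N → G → H → 1`, with `F : G → H`, is an extension of gerbes:
`F` is a weak epimorphism and `N = Ker(F)`. -/
structure IsExtension {G H : Gerbe.{w, v, u} X} (N : NormalSubgroupoid G) (F : GerbeHom G H) :
    Prop where
  isWeakEpi : IsWeakEpi F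
  eq_kernel : ∀ U : Opens X, N.on U = kernel (F.on U)

/-- The condition `D(N) ⊆ N'`. -/
def MapsInto {G G' : Gerbe.{w, v, u} X} (D : GerbeHom G G') (N : NormalSubgroupoid G)
    (N' : NormalSubgroupoid G') : Prop :=
  ∀ (U : Opens X) (i : G.Sec U) (a : i ⟶ i), a ∈ (N.on U).arrows i i →
    (D.on U).map a ∈ (N'.on U).arrows ((D.on U).obj i) ((D.on U).obj i)

/-- `(D, E)` is a morphism from the extension `1 → N → G → H → 1` to the extension
`1 → N' → G' → H' → 1`: the left square commutes, i.e. `D` restricts to `N → N'`, and the right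
square commutes up to 2-isomorphism, i.e. `E ∘ F` and `F' ∘ D` are 2-isomorphic. -/
structure IsMorphismOfExtensions {G H G' H' : Gerbe.{w, v, u} X}
    (N : NormalSubgroupoid G) (F : GerbeHom G H)
    (N' : NormalSubgroupoid G') (F' : GerbeHom G' H')
    (D : GerbeHom G G') (E : GerbeHom H H') : Prop where
  source : IsExtension N F
  target : IsExtension N' F'
  left_square : MapsInto D N N'
  right_square : Nonempty (F ≫ E ≅ D ≫ F')

/-- The sheaf homomorphisms `D : N(i, i) → N'(D(i), D(i))` are isomorphisms for all
local objects `i` of `G`. -/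
def InducesIso {G G' : Gerbe.{w, v, u} X} (D : GerbeHom G G') (N : NormalSubgroupoid G)
    (N' : NormalSubgroupoid G') : Prop :=
  ∀ (U : Opens X) (i : G.Sec U),
    Set.BijOn (fun a : i ⟶ i => (D.on U).map a) ((N.on U).arrows i i)
      ((N'.on U).arrows ((D.on U).obj i) ((D.on U).obj i))

end Gerbes

end GerbeExtension

/-! The quotient should be the stack associated with the prestack that has the objects of `G` and
the morphisms of `G` modulo `N`. Normality makes this relation a congruence (`Rel.comp`), and the
sheaf condition makes it local (`rel_of_rst`). The stack is written down directly. Local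
connectedness makes every stalk of the quotient prestack a connected groupoid; choose an object `o
z` in each. An object over `U` is an atlas: local objects of `G` covering `U`, their germs
trivialized pointwise against `o z`, with changes of charts that are locally morphisms of `G`. A
morphism is a family of automorphisms of the `o z` which, read in charts, is locally a morphism of
`G`. Pointwise data glue, so atlases form a stack (`isStack_prestack`); the projection is a weak
epimorphism (`isWeakEpi_proj`) identifying exactly the morphisms that agree modulo `N`
(`atlasMap_eq_iff`).

The universal property holds for any weak epimorphism `F : S ⟶ Q` and any `K : S ⟶ T` to a stack
that identifies whatever `F` identifies. An object `q` of `Q` is locally of the form `F(i)`, and the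
transitions between such charts lift locally to `S`; their images under `K` do not depend on the
lifts and glue the objects `K(i)` to an object of `T`. The result is recorded by a `Link`, a natural
transformation from `Hom(F(-), q)` to `Hom(K(-), h)` (`exists_link`). Between linked objects, every
morphism of `Q` has exactly one compatible morphism of `T` (`Compat.exists`, `Compat.unique`). This
gives functoriality of the extension and also its uniqueness. For (iii), a quasi-inverse of `D` maps
`N'` into `N`, hence induces a morphism in the opposite direction, and uniqueness makes it an
inverse of `E`.

To avoid coherence isomorphisms, these arguments take place in a `LocalGroupoid`: objects stay on
their domain, and morphisms between restrictions are restricted by `pullHom`, which is strictly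
functorial. Strictification loses nothing, for morphisms (`ofStrict`, `strictOfStrict`) or for
2-isomorphisms (`nonempty_iso_iff`). -/

namespace GerbeExtension

/-! ### Strictified prestacks of groupoids -/

/-- A presheaf of groupoids in which objects are kept on their domain of definition: for every open
`W` there is a groupoid whose objects include the restrictions `pt h x` of the objects `x` over
opens `U ⊇ W`, and morphisms between such restrictions restrict strictly functorially. -/
structure LocalGroupoid (X : Type w) [TopologicalSpace X] where
  /-- the objects over an open set -/
  Ob : Opens X → Type u
  /-- the groupoid of restricted objects -/
  At : Opens X → Type u
  /-- restriction of objects -/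
  pt {W U : Opens X} (h : W ≤ U) (x : Ob U) : At W
  groupoid (W : Opens X) : Groupoid.{v} (At W)
  /-- restriction of morphisms -/
  rst {W' W U V : Opens X} (h : W' ≤ W) {hU : W ≤ U} {hV : W ≤ V} {x : Ob U} {y : Ob V}
    (f : pt hU x ⟶ pt hV y) : pt (h.trans hU) x ⟶ pt (h.trans hV) y
  rst_id {W' W U : Opens X} (h : W' ≤ W) (hU : W ≤ U) (x : Ob U) : rst h (𝟙 (pt hU x)) = 𝟙 _
  rst_comp {W' W U V Y : Opens X} (h : W' ≤ W) {hU : W ≤ U} {hV : W ≤ V} {hY : W ≤ Y} {x : Ob U}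
    {y : Ob V} {z : Ob Y} (f : pt hU x ⟶ pt hV y) (g : pt hV y ⟶ pt hY z) :
    rst h (f ≫ g) = rst h f ≫ rst h g
  rst_rst {W'' W' W U V : Opens X} (h' : W'' ≤ W') (h : W' ≤ W) {hU : W ≤ U} {hV : W ≤ V} {x : Ob U}
    {y : Ob V} (f : pt hU x ⟶ pt hV y) : rst h' (rst h f) = rst (h'.trans h) f
  rst_self {W U V : Opens X} (h : W ≤ W) {hU : W ≤ U} {hV : W ≤ V} {x : Ob U} {y : Ob V}
    (f : pt hU x ⟶ pt hV y) : rst h f = f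

namespace LocalGroupoid

variable {X : Type w} [TopologicalSpace X]

instance (S : LocalGroupoid.{w, v, u} X) (W : Opens X) : Groupoid (S.At W) := S.groupoid W

attribute [simp] rst_id rst_comp rst_rst rst_self

@[simp]
theorem rst_inv (S : LocalGroupoid.{w, v, u} X) {W' W U V : Opens X} (h : W' ≤ W) {hU : W ≤ U}
    {hV : W ≤ V} {x : S.Ob U} {y : S.Ob V} (f : S.pt hU x ⟶ S.pt hV y) :
    S.rst h (inv f) = inv (S.rst h f) := by
  apply IsIso.eq_inv_of_hom_inv_id
  rw [← rst_comp, IsIso.hom_inv_id, rst_id]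

/-- Morphisms, strictly compatible with restriction. -/
structure Hom (S T : LocalGroupoid.{w, v, u} X) where
  /-- the map on objects -/
  obj {U : Opens X} : S.Ob U → T.Ob U
  /-- the map on local morphisms -/
  map {W U V : Opens X} {hU : W ≤ U} {hV : W ≤ V} {x : S.Ob U} {y : S.Ob V}
    (f : S.pt hU x ⟶ S.pt hV y) : T.pt hU (obj x) ⟶ T.pt hV (obj y)
  map_id {W U : Opens X} (hU : W ≤ U) (x : S.Ob U) : map (𝟙 (S.pt hU x)) = 𝟙 _
  map_comp {W U V Y : Opens X} {hU : W ≤ U} {hV : W ≤ V} {hY : W ≤ Y} {x : S.Ob U}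
    {y : S.Ob V} {z : S.Ob Y} (f : S.pt hU x ⟶ S.pt hV y) (g : S.pt hV y ⟶ S.pt hY z) :
    map (f ≫ g) = map f ≫ map g
  map_rst {W' W U V : Opens X} (h : W' ≤ W) {hU : W ≤ U} {hV : W ≤ V} {x : S.Ob U} {y : S.Ob V}
    (f : S.pt hU x ⟶ S.pt hV y) : map (S.rst h f) = T.rst h (map f)

namespace Hom

attribute [simp] map_id map_comp map_rst

variable {S T R : LocalGroupoid.{w, v, u} X}

/-- Composition of morphisms. -/
abbrev comp (F : Hom S T) (G : Hom T R) : Hom S R where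
  obj x := G.obj (F.obj x)
  map f := G.map (F.map f)
  map_id _ _ := by simp
  map_comp _ _ := by simp
  map_rst _ _ := by simp

/-- 2-morphisms. -/
structure Trans (F K : Hom S T) where
  /-- the components -/
  app {U : Opens X} (x : S.Ob U) : T.pt le_rfl (F.obj x) ⟶ T.pt le_rfl (K.obj x)
  naturality {W U V : Opens X} {hU : W ≤ U} {hV : W ≤ V} {x : S.Ob U} {y : S.Ob V}
    (f : S.pt hU x ⟶ S.pt hV y) : F.map f ≫ T.rst hV (app y) = T.rst hU (app x) ≫ K.map f

namespace Trans

/-- The inverse. -/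
noncomputable def symm {F K : Hom S T} (η : Trans F K) : Trans K F where
  app x := inv (η.app x)
  naturality f := by
    rw [rst_inv, rst_inv, IsIso.comp_inv_eq, Category.assoc, IsIso.eq_inv_comp, η.naturality]

/-- Composition. -/
def trans {F K L : Hom S T} (η : Trans F K) (θ : Trans K L) : Trans F L where
  app x := η.app x ≫ θ.app x
  naturality f := by
    rw [rst_comp, rst_comp, ← Category.assoc, η.naturality, Category.assoc, θ.naturality,
      Category.assoc]

/-- Left whiskering. -/
def whiskerLeft (F : Hom S T) {K L : Hom T R} (η : Trans K L) : Trans (F.comp K) (F.comp L) where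
  app x := η.app (F.obj x)
  naturality f := η.naturality (F.map f)

end Trans

/-- Local essential surjectivity and local fullness. -/
structure IsWeakEpi (F : Hom S T) : Prop where
  exists_obj {U : Opens X} (q : T.Ob U) (p : X) : p ∈ U →
    ∃ (V : Opens X) (h : V ≤ U) (i : S.Ob V), p ∈ V ∧ Nonempty (T.pt le_rfl (F.obj i) ⟶ T.pt h q)
  exists_map {W U V : Opens X} {hU : W ≤ U} {hV : W ≤ V} {x : S.Ob U} {y : S.Ob V}
    (f : T.pt hU (F.obj x) ⟶ T.pt hV (F.obj y)) (p : X) : p ∈ W →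
    ∃ (W' : Opens X) (h : W' ≤ W) (g : S.pt (h.trans hU) x ⟶ S.pt (h.trans hV) y),
      p ∈ W' ∧ F.map g = T.rst h f

end Hom

/-- Morphisms and objects glue. -/
structure IsStack (T : LocalGroupoid.{w, v, u} X) : Prop where
  hom_ext {W U V : Opens X} {hU : W ≤ U} {hV : W ≤ V} {x : T.Ob U} {y : T.Ob V}
    (f g : T.pt hU x ⟶ T.pt hV y) :
    (∀ p ∈ W, ∃ (W' : Opens X) (h : W' ≤ W), p ∈ W' ∧ T.rst h f = T.rst h g) → f = g
  hom_glue {W U V : Opens X} (hU : W ≤ U) (hV : W ≤ V) (x : T.Ob U) (y : T.Ob V)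
    (R : ∀ (W' : Opens X) (h : W' ≤ W), (T.pt (h.trans hU) x ⟶ T.pt (h.trans hV) y) → Prop) :
    (∀ p ∈ W, ∃ (W' : Opens X) (h : W' ≤ W) (f : _), p ∈ W' ∧ R W' h f) →
    (∀ (W₁ W₂ : Opens X) (h₁ : W₁ ≤ W) (h₂ : W₂ ≤ W) (f₁ f₂ : _), R W₁ h₁ f₁ → R W₂ h₂ f₂ →
      ∀ p ∈ W₁ ⊓ W₂, ∃ (W' : Opens X) (k₁ : W' ≤ W₁) (k₂ : W' ≤ W₂),
        p ∈ W' ∧ T.rst k₁ f₁ = T.rst k₂ f₂) →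
    ∃ f : T.pt hU x ⟶ T.pt hV y, ∀ (W' : Opens X) (h : W' ≤ W) (g : _), R W' h g → T.rst h f = g
  obj_glue {U : Opens X} {ι : Type u} (V : ι → Opens X) (hV : ∀ k, V k ≤ U)
    (cover : ∀ p ∈ U, ∃ k, p ∈ V k) (Y : ι → Opens X) (hY : ∀ k, V k ≤ Y k) (x : ∀ k, T.Ob (Y k))
    (φ : ∀ k l, T.pt ((inf_le_left : V k ⊓ V l ≤ V k).trans (hY k)) (x k) ⟶
      T.pt ((inf_le_right : V k ⊓ V l ≤ V l).trans (hY l)) (x l)) :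
    (∀ (k l m) (W : Opens X) (hk : W ≤ V k) (hl : W ≤ V l) (hm : W ≤ V m),
      T.rst (le_inf hk hl) (φ k l) ≫ T.rst (le_inf hl hm) (φ l m) = T.rst (le_inf hk hm) (φ k m)) →
    ∃ (y : T.Ob U) (e : ∀ k, T.pt (hY k) (x k) ⟶ T.pt (hV k) y),
      ∀ k l, φ k l ≫ T.rst inf_le_right (e l) = T.rst inf_le_left (e k)

end LocalGroupoid

end GerbeExtension

/-! ### Links between objects, and the morphisms compatible with them. -/

namespace GerbeExtension
namespace LocalGroupoid

variable {X : Type w} [TopologicalSpace X] {S Q T : LocalGroupoid.{w, v, u} X}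

/-- A link between objects `q` of `Q` and `h` of `T`, along `F : S ⟶ Q` and `K : S ⟶ T`: a natural
transformation from `Hom(F(-), q)` to `Hom(K(-), h)`. -/
structure Link (F : Hom S Q) (K : Hom S T) {U : Opens X} (q : Q.Ob U) (h : T.Ob U) where
  /-- the natural transformation -/
  app {V Y : Opens X} {hV : V ≤ U} {hY : V ≤ Y} {i : S.Ob Y}
    (α : Q.pt hY (F.obj i) ⟶ Q.pt hV q) : T.pt hY (K.obj i) ⟶ T.pt hV h
  app_rst {V' V Y : Opens X} (k : V' ≤ V) {hV : V ≤ U} {hY : V ≤ Y} {i : S.Ob Y}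
    (α : Q.pt hY (F.obj i) ⟶ Q.pt hV q) : app (Q.rst k α) = T.rst k (app α)
  app_map {V Y Y' : Opens X} {hV : V ≤ U} {hY : V ≤ Y} {hY' : V ≤ Y'} {i : S.Ob Y} {j : S.Ob Y'}
    (g : S.pt hY' j ⟶ S.pt hY i) (α : Q.pt hY (F.obj i) ⟶ Q.pt hV q) :
    app (F.map g ≫ α) = K.map g ≫ app α

namespace Link

variable {F : Hom S Q} {K : Hom S T}

/-- Locally every point of the domain of `q` carries a chart `F(i) ⟶ q`. -/
theorem exists_chart (hF : F.IsWeakEpi) {W U : Opens X} (hW : W ≤ U) (q : Q.Ob U) {p : X}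
    (hp : p ∈ W) :
    ∃ (V Y : Opens X) (h : V ≤ W) (hY : V ≤ Y) (i : S.Ob Y), p ∈ V ∧
      Nonempty (Q.pt hY (F.obj i) ⟶ Q.pt (h.trans hW) q) := by
  obtain ⟨Y, hY, i, hpY, ⟨α⟩⟩ := hF.exists_obj q p (hW hp)
  exact ⟨Y ⊓ W, Y, inf_le_right, inf_le_left, i, ⟨hpY, hp⟩, ⟨Q.rst inf_le_left α⟩⟩

/-- Compatibility of a morphism between linked objects with the links. -/
def Compat {U U' : Opens X} {q : Q.Ob U} {h : T.Ob U} {q' : Q.Ob U'} {h' : T.Ob U'}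
    (L : Link F K q h) (L' : Link F K q' h') {W : Opens X} {hU : W ≤ U} {hU' : W ≤ U'}
    (m : Q.pt hU q ⟶ Q.pt hU' q') (n : T.pt hU h ⟶ T.pt hU' h') : Prop :=
  ∀ ⦃V Y : Opens X⦄ (hV : V ≤ W) ⦃hY : V ≤ Y⦄ ⦃i : S.Ob Y⦄
    (α : Q.pt hY (F.obj i) ⟶ Q.pt (hV.trans hU) q),
    L.app α ≫ T.rst hV n = L'.app (α ≫ Q.rst hV m)

variable {U U' U'' : Opens X} {q : Q.Ob U} {h : T.Ob U} {q' : Q.Ob U'} {h' : T.Ob U'}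
  {q'' : Q.Ob U''} {h'' : T.Ob U''}
  {L : Link F K q h} {L' : Link F K q' h'} {L'' : Link F K q'' h''} {W : Opens X} {hU : W ≤ U}
  {hU' : W ≤ U'} {hU'' : W ≤ U''}

/-- On a chart `α` the morphism must be `inv (L.app α) ≫ L'.app (α ≫ m)`; charts exist near every
point, and morphisms of a stack are determined locally. -/
theorem Compat.unique (hF : F.IsWeakEpi) (hT : T.IsStack) {m : Q.pt hU q ⟶ Q.pt hU' q'}
    {n n' : T.pt hU h ⟶ T.pt hU' h'} (hn : Compat L L' m n) (hn' : Compat L L' m n') : n = n' := by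
  refine hT.hom_ext _ _ fun p hp => ?_
  obtain ⟨V, Y, k, hY, i, hpV, ⟨α⟩⟩ := exists_chart hF hU q hp
  refine ⟨V, k, hpV, ?_⟩
  rw [← cancel_epi (L.app α)]
  exact (hn k α).trans (hn' k α).symm

/-- The formula forced by a chart is glued over all charts. Two charts differ locally by some `F.map
g`, and naturality of the links in `g` shows that they give the same morphism. -/
theorem Compat.exists (hF : F.IsWeakEpi) (hT : T.IsStack) (L : Link F K q h) (L' : Link F K q' h')
    (m : Q.pt hU q ⟶ Q.pt hU' q') : ∃ n : T.pt hU h ⟶ T.pt hU' h', Compat L L' m n := by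
  obtain ⟨n, hn⟩ := hT.hom_glue hU hU' h h' (fun V hV f => ∃ (Y : Opens X) (hY : V ≤ Y) (i : S.Ob Y)
    (α : Q.pt hY (F.obj i) ⟶ Q.pt (hV.trans hU) q), L.app α ≫ f = L'.app (α ≫ Q.rst hV m)) (by
      intro p hp
      obtain ⟨V, Y, k, hY, i, hpV, ⟨α⟩⟩ := exists_chart hF hU q hp
      exact ⟨V, k, inv (L.app α) ≫ L'.app (α ≫ Q.rst k m), hpV, Y, hY, i, α, by simp⟩)
    (by
      rintro V₁ V₂ k₁ k₂ f₁ f₂ ⟨Y₁, hY₁, i₁, α₁, e₁⟩ ⟨Y₂, hY₂, i₂, α₂, e₂⟩ p hp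
      -- Local fullness lifts the transition from `α₁` to `α₂` to a morphism `g` of `S`.
      obtain ⟨W', k, g, hp', hg⟩ := hF.exists_map
        (Q.rst (inf_le_left : V₁ ⊓ V₂ ≤ V₁) α₁ ≫ inv (Q.rst (inf_le_right : V₁ ⊓ V₂ ≤ V₂) α₂)) p hp
      refine ⟨W', k.trans inf_le_left, k.trans inf_le_right, hp', ?_⟩
      rw [rst_comp, rst_rst, rst_inv, rst_rst] at hg
      have e : Q.rst (k.trans inf_le_left) α₁ = F.map g ≫ Q.rst (k.trans inf_le_right) α₂ := by
        simp [hg]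
      have h₁ := congrArg (T.rst (k.trans inf_le_left)) e₁
      have h₂ := congrArg (T.rst (k.trans inf_le_right)) e₂
      rw [rst_comp, ← app_rst, ← app_rst, rst_comp, rst_rst] at h₁ h₂
      rw [e, app_map, Category.assoc, Category.assoc, app_map, ← h₂] at h₁
      rwa [cancel_epi, cancel_epi] at h₁)
  refine ⟨n, fun V Y hV hY i α => ?_⟩
  rw [hn V hV (inv (L.app α) ≫ L'.app (α ≫ Q.rst hV m)) ⟨Y, hY, i, α, by simp⟩,
    IsIso.hom_inv_id_assoc]

theorem Compat.id (L : Link F K q h) : Compat L L (𝟙 (Q.pt hU q)) (𝟙 (T.pt hU h)) := by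
  intro V Y hV hY i α
  simp

theorem Compat.comp {m : Q.pt hU q ⟶ Q.pt hU' q'} {n : T.pt hU h ⟶ T.pt hU' h'}
    {m' : Q.pt hU' q' ⟶ Q.pt hU'' q''} {n' : T.pt hU' h' ⟶ T.pt hU'' h''}
    (hn : Compat L L' m n) (hn' : Compat L' L'' m' n') : Compat L L'' (m ≫ m') (n ≫ n') := by
  intro V Y hV hY i α
  rw [rst_comp, rst_comp, ← Category.assoc, ← Category.assoc, hn, hn']

theorem Compat.rst {m : Q.pt hU q ⟶ Q.pt hU' q'} {n : T.pt hU h ⟶ T.pt hU' h'}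
    (hn : Compat L L' m n) {W' : Opens X} (k : W' ≤ W) : Compat L L' (Q.rst k m) (T.rst k n) := by
  intro V Y hV hY i α
  rw [rst_rst, rst_rst, hn]

end Link
end LocalGroupoid

end GerbeExtension

/-! ### Extension of morphisms along weak epimorphisms. -/

namespace GerbeExtension
namespace LocalGroupoid

variable {X : Type w} [TopologicalSpace X] {S Q T : LocalGroupoid.{w, v, u} X}

namespace Link

variable {F : Hom S Q} {K : Hom S T}

/-- Lifting of morphisms along a weak epimorphism `F` to `T`, when `K` factors through the
congruence defined by `F`. -/
theorem exists_lift (hF : F.IsWeakEpi) (hT : T.IsStack)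
    (hK : ∀ {W U V : Opens X} {hU : W ≤ U} {hV : W ≤ V} {x : S.Ob U} {y : S.Ob V}
      (f g : S.pt hU x ⟶ S.pt hV y), F.map f = F.map g → K.map f = K.map g)
    {W U V : Opens X} {hU : W ≤ U} {hV : W ≤ V} {x : S.Ob U} {y : S.Ob V}
    (φ : Q.pt hU (F.obj x) ⟶ Q.pt hV (F.obj y)) :
    ∃ ψ : T.pt hU (K.obj x) ⟶ T.pt hV (K.obj y), ∀ (W' : Opens X) (k : W' ≤ W)
      (g : S.pt (k.trans hU) x ⟶ S.pt (k.trans hV) y), F.map g = Q.rst k φ →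
        T.rst k ψ = K.map g := by
  obtain ⟨ψ, hψ⟩ := hT.hom_glue hU hV (K.obj x) (K.obj y) (fun W' k f =>
    ∃ g : S.pt (k.trans hU) x ⟶ S.pt (k.trans hV) y, F.map g = Q.rst k φ ∧ f = K.map g) (by
      intro p hp
      obtain ⟨W', k, g, hp', hg⟩ := hF.exists_map φ p hp
      exact ⟨W', k, _, hp', g, hg, rfl⟩)
    (by
      rintro W₁ W₂ k₁ k₂ _ _ ⟨g₁, h₁, rfl⟩ ⟨g₂, h₂, rfl⟩ p hp
      refine ⟨W₁ ⊓ W₂, inf_le_left, inf_le_right, hp, ?_⟩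
      rw [← Hom.map_rst, ← Hom.map_rst]
      apply hK
      rw [Hom.map_rst, Hom.map_rst, h₁, h₂, rst_rst, rst_rst])
  exact ⟨ψ, fun W' k g hg => hψ W' k _ ⟨g, hg, rfl⟩⟩

/-- The index set of charts of an object `q`. -/
structure Chart (F : Hom S Q) {U : Opens X} (q : Q.Ob U) where
  /-- the domain of the chart -/
  V : Opens X
  /-- the domain of the local object -/
  Y : Opens X
  hV : V ≤ U
  hY : V ≤ Y
  /-- the local object -/
  i : S.Ob Y
  /-- the chart -/
  α : Q.pt hY (F.obj i) ⟶ Q.pt hV q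

end Link
end LocalGroupoid

namespace LocalGroupoid

variable {X : Type v} [TopologicalSpace X] {S Q T : LocalGroupoid.{v, v, max u v} X}

namespace Link

variable {F : Hom S Q} {K : Hom S T}

/-- Descent in `T`: the objects `K(i)`, one for each chart of `q`, are glued along the lifted
transitions. The universe `max u v` of objects is large enough to index the gluing by all charts. -/
theorem exists_link (hF : F.IsWeakEpi) (hT : T.IsStack)
    (hK : ∀ {W U V : Opens X} {hU : W ≤ U} {hV : W ≤ V} {x : S.Ob U} {y : S.Ob V}
      (f g : S.pt hU x ⟶ S.pt hV y), F.map f = F.map g → K.map f = K.map g)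
    {U : Opens X} (q : Q.Ob U) : ∃ h : T.Ob U, Nonempty (Link F K q h) := by
  choose φ hφ using fun (c d : Chart F q) => exists_lift (K := K) hF hT hK
    (Q.rst (inf_le_left : c.V ⊓ d.V ≤ c.V) c.α ≫ inv (Q.rst (inf_le_right : c.V ⊓ d.V ≤ d.V) d.α))
  -- Wherever the transition between two charts lifts to some `g`, the gluing morphism is `K.map g`.
  -- Since lifts exist locally, the cocycle condition can be checked on them.
  have key : ∀ (c d : Chart F q) (W : Opens X) (hc : W ≤ c.V) (hd : W ≤ d.V)
      (g : S.pt (hc.trans c.hY) c.i ⟶ S.pt (hd.trans d.hY) d.i),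
      F.map g ≫ Q.rst hd d.α = Q.rst hc c.α → T.rst (le_inf hc hd) (φ c d) = K.map g := by
    intro c d W hc hd g hg
    apply hφ
    rw [rst_comp, rst_rst, rst_inv, rst_rst, ← hg]
    simp
  have lift : ∀ (c d : Chart F q) (W : Opens X) (hc : W ≤ c.V) (hd : W ≤ d.V) (p : X), p ∈ W →
      ∃ (W' : Opens X) (k : W' ≤ W)
        (g : S.pt (k.trans (hc.trans c.hY)) c.i ⟶ S.pt (k.trans (hd.trans d.hY)) d.i),
        p ∈ W' ∧ F.map g ≫ Q.rst (k.trans hd) d.α = Q.rst (k.trans hc) c.α := by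
    intro c d W hc hd p hp
    obtain ⟨W', k, g, hp', hg⟩ := hF.exists_map (Q.rst hc c.α ≫ inv (Q.rst hd d.α)) p hp
    refine ⟨W', k, g, hp', ?_⟩
    rw [hg]
    simp
  obtain ⟨h, e, he⟩ := hT.obj_glue (U := U) (ι := Chart F q) (fun c => c.V) (fun c => c.hV) (by
      intro p hp
      obtain ⟨V, Y, h, hY, i, hp', ⟨α⟩⟩ := exists_chart hF le_rfl q hp
      exact ⟨⟨V, Y, h, hY, i, α⟩, hp'⟩)
    (fun c => c.Y) (fun c => c.hY) (fun c => K.obj c.i) φ (by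
      intro c d d' W hc hd hd'
      refine hT.hom_ext _ _ fun p hp => ?_
      obtain ⟨W₁, k₁, g₁, hp₁, hg₁⟩ := lift c d W hc hd p hp
      -- The second lift is taken inside the domain of the first, so that the composite of both is
      -- defined on `W₂` and lifts the transition from `c` to `d'`.
      obtain ⟨W₂, k₂, g₂, hp₂, hg₂⟩ := lift d d' W₁ (k₁.trans hd) (k₁.trans hd') p hp₁
      refine ⟨W₂, k₂.trans k₁, hp₂, ?_⟩
      have e₁ := key c d W₂ _ ((k₂.trans k₁).trans hd) (S.rst k₂ g₁) (by
        have := congrArg (Q.rst k₂) hg₁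
        simpa using this)
      have e₂ := key d d' W₂ ((k₂.trans k₁).trans hd) _ g₂ hg₂
      have e₃ := key c d' W₂ ((k₂.trans k₁).trans hc) ((k₂.trans k₁).trans hd')
          (S.rst k₂ g₁ ≫ g₂) (by
        have := congrArg (Q.rst k₂) hg₁
        simp only [rst_comp, rst_rst, ← Hom.map_rst] at this
        rw [Hom.map_comp, Category.assoc, hg₂, this])
      rw [rst_comp, rst_rst, rst_rst, rst_rst, e₁, e₂, e₃, Hom.map_comp])
  have he' : ∀ (c d : Chart F q) (W : Opens X) (hc : W ≤ c.V) (hd : W ≤ d.V)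
      (g : S.pt (hc.trans c.hY) c.i ⟶ S.pt (hd.trans d.hY) d.i),
      F.map g ≫ Q.rst hd d.α = Q.rst hc c.α → K.map g ≫ T.rst hd (e d) = T.rst hc (e c) := by
    intro c d W hc hd g hg
    have := congrArg (T.rst (le_inf hc hd)) (he c d)
    rwa [rst_comp, rst_rst, rst_rst, key c d W hc hd g hg] at this
  -- Every morphism `F(i) ⟶ q` is itself a chart, so the isomorphisms `e` onto the glued object
  -- already constitute the link.
  refine ⟨h, ⟨⟨fun {V Y hV hY i} α => e ⟨V, Y, hV, hY, i, α⟩, ?_, ?_⟩⟩⟩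
  · intro V' V Y k hV hY i α
    have := he' ⟨V', Y, k.trans hV, k.trans hY, i, Q.rst k α⟩ ⟨V, Y, hV, hY, i, α⟩ V' le_rfl k (𝟙 _)
      (by simp)
    simpa using this.symm
  · intro V Y Y' hV hY hY' i j g α
    have := he' ⟨V, Y', hV, hY', j, F.map g ≫ α⟩ ⟨V, Y, hV, hY, i, α⟩ V le_rfl le_rfl g
      (by simp)
    simpa using this.symm

end Link

/-- Universal property of weak epimorphisms: a morphism to a stack that identifies all local
morphisms identified by `F` extends along `F`. -/
theorem exists_extension {F : Hom S Q} {K : Hom S T} (hF : F.IsWeakEpi) (hT : T.IsStack)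
    (hK : ∀ {W U V : Opens X} {hU : W ≤ U} {hV : W ≤ V} {x : S.Ob U} {y : S.Ob V}
      (f g : S.pt hU x ⟶ S.pt hV y), F.map f = F.map g → K.map f = K.map g) :
    ∃ E : Hom Q T, Nonempty (Hom.Trans (F.comp E) K) := by
  choose h hl using fun (U : Opens X) (q : Q.Ob U) => Link.exists_link hF hT hK q
  let L := fun (U : Opens X) (q : Q.Ob U) => (hl U q).some
  choose n hn using fun {W U V : Opens X} {hU : W ≤ U} {hV : W ≤ V} {x : Q.Ob U} {y : Q.Ob V}
      (m : Q.pt hU x ⟶ Q.pt hV y) => Link.Compat.exists hF hT (L U x) (L V y) m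
  let E : Hom Q T :=
    { obj q := h _ q
      map m := n m
      map_id hU x := Link.Compat.unique hF hT (hn _) (Link.Compat.id _)
      map_comp f g := Link.Compat.unique hF hT (hn _) ((hn f).comp (hn g))
      map_rst := by
        intros
        exact Link.Compat.unique hF hT (hn _) ((hn _).rst _) }
  -- The object `F(x)` has the tautological chart `𝟙`, whose value under the link is a morphism from
  -- `K(x)` to `E(F(x))`.
  refine ⟨E, ⟨Hom.Trans.symm ⟨fun {U} x => (L U (F.obj x)).app (𝟙 _), ?_⟩⟩⟩
  intro W U V hU hV x y f
  have h₁ := hn (F.map f) le_rfl (𝟙 _)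
  have h₂ := (L V (F.obj y)).app_map f (𝟙 _)
  rw [Category.id_comp, rst_self, rst_self] at h₁
  rw [Category.comp_id] at h₂
  have r₁ := (L U (F.obj x)).app_rst hU (𝟙 (Q.pt le_rfl (F.obj x)))
  have r₂ := (L V (F.obj y)).app_rst hV (𝟙 (Q.pt le_rfl (F.obj y)))
  rw [rst_id] at r₁ r₂
  rw [r₁] at h₁
  rw [r₂] at h₂
  exact h₂.symm.trans h₁.symm

/-- Extensions along weak epimorphisms are unique up to isomorphism. -/
theorem exists_trans_of_comp {F : Hom S Q} (hF : F.IsWeakEpi) (hT : T.IsStack) {E E' : Hom Q T}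
    (η : Hom.Trans (F.comp E) (F.comp E')) : Nonempty (Hom.Trans E E') := by
  -- Both `E(q)` and `E'(q)` are linked to `q` along the same pair, the first by `E` itself and the
  -- second by `E'` after `η`; the component at `q` is the morphism compatible with `𝟙`.
  let L : ∀ {U : Opens X} (q : Q.Ob U), Link F (F.comp E) q (E.obj q) := fun q =>
    { app α := E.map α
      app_rst := by
        intros
        exact E.map_rst _ _
      app_map g α := E.map_comp _ _ }
  let L' : ∀ {U : Opens X} (q : Q.Ob U), Link F (F.comp E) q (E'.obj q) := fun q =>
    { app {V Y hV hY i} α := T.rst hY (η.app i) ≫ E'.map α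
      app_rst := by
        intros
        rw [E'.map_rst, T.rst_comp, T.rst_rst]
      app_map g α := by
        have := η.naturality g
        rw [Hom.map_comp, ← Category.assoc, ← Category.assoc]
        exact congrArg (· ≫ E'.map α) this.symm }
  choose n hn using fun {U : Opens X} (q : Q.Ob U) =>
    Link.Compat.exists hF hT (L q) (L' q) (𝟙 (Q.pt le_rfl q))
  refine ⟨⟨fun q => n q, ?_⟩⟩
  intro W U V hU hV x y f
  have a : Link.Compat (L x) (L y) f (E.map f) := fun V Y hV hY i α => by
    change E.map α ≫ _ = E.map _
    rw [E.map_comp, E.map_rst]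
  have b : Link.Compat (L' x) (L' y) f (E'.map f) := fun V Y hV hY i α => by
    change (T.rst hY (η.app i) ≫ E'.map α) ≫ _ = T.rst hY (η.app i) ≫ E'.map _
    rw [E'.map_comp, E'.map_rst, Category.assoc]
  have c := a.comp ((hn y).rst hV)
  have d := ((hn x).rst hU).comp b
  rw [rst_id, Category.comp_id] at c
  rw [rst_id, Category.id_comp] at d
  exact Link.Compat.unique hF hT c d

end LocalGroupoid

end GerbeExtension

/-! ### Strictification of gerbes, and the coherence of restrictions. -/

namespace GerbeExtension
open Pseudofunctor.LocallyDiscreteOpToCat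

variable {X : Type w} [TopologicalSpace X]

section PullHom

variable {C : Type*} [Category* C] {F : LocallyDiscrete Cᵒᵖ ⥤ᵖ Cat.{v, u}}

theorem pullHom_identity ⦃X₁ : C⦄ (M₁ : F.obj (.mk (op X₁))) ⦃Y : C⦄ (f₁ : Y ⟶ X₁) ⦃Y' : C⦄
    (g : Y' ⟶ Y) (gf₁ : Y' ⟶ X₁) (hgf₁ : g ≫ f₁ = gf₁) :
    pullHom (F := F) (M₁ := M₁) (M₂ := M₁) (𝟙 ((F.map f₁.op.toLoc).toFunctor.obj M₁)) g gf₁ gf₁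
      hgf₁ hgf₁ = 𝟙 _ := by
  rw [pullHom, CategoryTheory.Functor.map_id]
  exact (congrArg _ (Category.id_comp _)).trans (Cat.Hom.hom_inv_id_toNatTrans_app _ _)

theorem pullHom_comp ⦃X₁ X₂ X₃ : C⦄ ⦃M₁ : F.obj (.mk (op X₁))⦄ ⦃M₂ : F.obj (.mk (op X₂))⦄
    ⦃M₃ : F.obj (.mk (op X₃))⦄
    ⦃Y : C⦄ ⦃f₁ : Y ⟶ X₁⦄ ⦃f₂ : Y ⟶ X₂⦄ ⦃f₃ : Y ⟶ X₃⦄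
    (φ : (F.map f₁.op.toLoc).toFunctor.obj M₁ ⟶ (F.map f₂.op.toLoc).toFunctor.obj M₂)
    (ψ : (F.map f₂.op.toLoc).toFunctor.obj M₂ ⟶ (F.map f₃.op.toLoc).toFunctor.obj M₃) ⦃Y' : C⦄
    (g : Y' ⟶ Y) (gf₁ : Y' ⟶ X₁) (gf₂ : Y' ⟶ X₂) (gf₃ : Y' ⟶ X₃) (hgf₁ : g ≫ f₁ = gf₁)
    (hgf₂ : g ≫ f₂ = gf₂) (hgf₃ : g ≫ f₃ = gf₃) :
    pullHom (φ ≫ ψ) g gf₁ gf₃ hgf₁ hgf₃ =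
      pullHom φ g gf₁ gf₂ hgf₁ hgf₂ ≫ pullHom ψ g gf₂ gf₃ hgf₂ hgf₃ := by
  simp only [pullHom, Functor.map_comp, Category.assoc, Cat.Hom.inv_hom_id_toNatTrans_app_assoc]

end PullHom

/-- Restriction of local morphisms of a gerbe. -/
def Gerbe.rst (G : Gerbe.{w, v, u} X) {W' W U V : Opens X} (h : W' ≤ W) (hU : W ≤ U) (hV : W ≤ V)
    {x : G.Sec U} {y : G.Sec V} (f : (G.res hU).obj x ⟶ (G.res hV).obj y) :
    (G.res (h.trans hU)).obj x ⟶ (G.res (h.trans hV)).obj y :=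
  pullHom (F := G.toPrestack.toPseudofunctor) (M₁ := x) (M₂ := y) f (homOfLE h)
    (homOfLE (h.trans hU)) (homOfLE (h.trans hV)) rfl rfl

/-- The strictification of a gerbe. -/
noncomputable abbrev Gerbe.strict (G : Gerbe.{w, v, u} X) : LocalGroupoid.{w, v, u} X where
  Ob U := G.Sec U
  At W := G.Sec W
  pt h x := (G.res h).obj x
  groupoid W := G.groupoidSec W
  rst {_ _ _ _} h {hU hV _ _} f := G.rst h hU hV f
  rst_id h hU x := pullHom_identity (F := G.toPrestack.toPseudofunctor) x (homOfLE hU) (homOfLE h)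
    (homOfLE (h.trans hU)) rfl
  rst_comp {_ _ _ _ _} h {hU hV hY _ _ _} f g :=
    pullHom_comp (F := G.toPrestack.toPseudofunctor) f g (homOfLE h) (homOfLE (h.trans hU))
    (homOfLE (h.trans hV)) (homOfLE (h.trans hY)) rfl rfl rfl
  rst_rst {_ _ _ _ _} h' h {hU hV _ _} f :=
    pullHom_pullHom (F := G.toPrestack.toPseudofunctor) f (homOfLE h) (homOfLE (h.trans hU))
      (homOfLE (h.trans hV)) (homOfLE h') (homOfLE (h'.trans (h.trans hU)))
      (homOfLE (h'.trans (h.trans hV))) rfl rfl rfl rfl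
  rst_self {_ _ _} _ {_ _ _ _} f := pullHom_id (F := G.toPrestack.toPseudofunctor) f

end GerbeExtension

namespace GerbeExtension
open Pseudofunctor.LocallyDiscreteOpToCat

variable {X : Type w} [TopologicalSpace X]

namespace Gerbe

variable (G : Gerbe.{w, v, u} X) {W' W V U Y : Opens X}

/-- The comparison of a restriction with an iterated restriction. -/
def cart (h : W ≤ V) (k : V ≤ U) (x : G.Sec U) :
    (G.res h).obj ((G.res k).obj x) ≅ (G.res (h.trans k)).obj x :=
  (Cat.Hom.toNatIso (G.toPrestack.mapComp' (homOfLE k).op.toLoc (homOfLE h).op.toLoc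
    (homOfLE (h.trans k)).op.toLoc rfl)).symm.app x

/-- The comparison of an object with its restriction to its domain. -/
def unitor (x : G.Sec U) : (G.res le_rfl).obj x ≅ x :=
  (Cat.Hom.toNatIso (G.toPrestack.mapId (.mk (op U)))).app x

theorem unitor_naturality {x y : G.Sec U} (f : x ⟶ y) :
    (G.res le_rfl).map f ≫ (G.unitor y).hom = (G.unitor x).hom ≫ f :=
  (G.toPrestack.mapId (.mk (op U))).hom.toNatTrans.naturality f

theorem map_comp_cart (h : W' ≤ W) {hU : W ≤ U} {hV : W ≤ V} {x : G.Sec U} {y : G.Sec V}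
    (f : (G.res hU).obj x ⟶ (G.res hV).obj y) :
    (G.res h).map f ≫ (G.cart h hV y).hom = (G.cart h hU x).hom ≫ G.rst h hU hV f :=
  (Iso.inv_comp_eq _).1 (by
    rfl : (G.cart h hU x).inv ≫ (G.res h).map f ≫ (G.cart h hV y).hom = G.rst h hU hV f)

theorem cart_naturality (h : W ≤ V) (k : V ≤ U) {x y : G.Sec U} (f : x ⟶ y) :
    (G.res h).map ((G.res k).map f) ≫ (G.cart h k y).hom =
      (G.cart h k x).hom ≫ (G.res (h.trans k)).map f :=
  (G.toPrestack.mapComp' (homOfLE k).op.toLoc (homOfLE h).op.toLoc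
    (homOfLE (h.trans k)).op.toLoc rfl).inv.toNatTrans.naturality f

theorem rst_map (h : W ≤ V) (k : V ≤ U) {x y : G.Sec U} (f : x ⟶ y) :
    G.rst h k k ((G.res k).map f) = (G.res (h.trans k)).map f := by
  rw [← cancel_epi (G.cart h k x).hom, ← cart_naturality, ← map_comp_cart]

theorem cart_rfl_left (k : V ≤ U) (x : G.Sec U) :
    (G.cart le_rfl k x).hom = (G.unitor ((G.res k).obj x)).hom := by
  exact Pseudofunctor.mapComp'_comp_id_inv_app G.toPrestack.toPseudofunctor
    (homOfLE k).op.toLoc x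

theorem cart_rfl_right (k : V ≤ U) (x : G.Sec U) :
    (G.cart k le_rfl x).hom = (G.res k).map (G.unitor x).hom := by
  exact Pseudofunctor.mapComp'_id_comp_inv_app G.toPrestack.toPseudofunctor
    (homOfLE k).op.toLoc x

/-- Associativity coherence of the pseudofunctor, rephrased: the comparisons `cart`, seen as local
morphisms, restrict strictly to one another. -/
theorem rst_cart (h' : W' ≤ W) (h : W ≤ V) (k : V ≤ U) (x : G.Sec U) :
    G.rst h' h (h.trans k) (G.cart h k x).hom = (G.cart (h'.trans h) k x).hom := by
  rw [← cancel_epi (G.cart h' h ((G.res k).obj x)).hom, ← map_comp_cart]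
  exact Pseudofunctor.mapComp'_inv_whiskerRight_mapComp'₀₂₃_inv_app
    G.toPrestack.toPseudofunctor (homOfLE k).op.toLoc (homOfLE h).op.toLoc (homOfLE h').op.toLoc
    (homOfLE (h.trans k)).op.toLoc (homOfLE (h'.trans h)).op.toLoc
    (homOfLE (h'.trans (h.trans k))).op.toLoc rfl rfl rfl x

end Gerbe

namespace PrestackHom

variable {G H : Gerbe.{w, v, u} X} (F : GerbeHom G H) {W V U : Opens X}

theorem psi_naturality (h : V ≤ U) {x y : G.Sec U} (f : x ⟶ y) :
    (F.on V).map ((G.res h).map f) ≫ F.psi h y = F.psi h x ≫ (H.res h).map ((F.on U).map f) :=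
  (F.naturality (homOfLE h).op.toLoc).hom.toNatTrans.naturality f

theorem psi_comp (h : W ≤ V) (k : V ≤ U) (x : G.Sec U) :
    (F.on W).map (G.cart h k x).hom ≫ F.psi (h.trans k) x =
      F.psi h ((G.res k).obj x) ≫ (H.res h).map (F.psi k x) ≫
        (H.cart h k ((F.on U).obj x)).hom := by
  have e := Pseudofunctor.StrongTrans.naturality_comp_hom_app F (homOfLE k).op.toLoc
    (homOfLE h).op.toLoc x
  have e₁ : (G.cart h k x).inv =
      (G.toPrestack.mapComp (homOfLE k).op.toLoc (homOfLE h).op.toLoc).hom.toNatTrans.app x :=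
    congrArg (fun t => t.hom.toNatTrans.app x) (Pseudofunctor.mapComp'_eq_mapComp
      G.toPrestack.toPseudofunctor (homOfLE k).op.toLoc (homOfLE h).op.toLoc)
  have e₂ : (H.cart h k ((F.on U).obj x)).hom =
      (H.toPrestack.mapComp (homOfLE k).op.toLoc (homOfLE h).op.toLoc).inv.toNatTrans.app
        ((F.on U).obj x) :=
    congrArg (fun t => t.inv.toNatTrans.app ((F.on U).obj x)) (Pseudofunctor.mapComp'_eq_mapComp
      H.toPrestack.toPseudofunctor (homOfLE k).op.toLoc (homOfLE h).op.toLoc)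
  rw [← Functor.mapIso_hom, ← Iso.eq_inv_comp, Functor.mapIso_inv, e₁, e₂]
  exact e

theorem psi_rfl (x : G.Sec U) :
    F.psi le_rfl x ≫ (H.unitor ((F.on U).obj x)).hom = (F.on U).map (G.unitor x).hom := by
  rw [← Iso.eq_comp_inv]
  exact Pseudofunctor.StrongTrans.naturality_id_hom_app F (.mk (op U)) x

end PrestackHom

end GerbeExtension

/-! ### Strictification of morphisms and 2-morphisms. -/

namespace GerbeExtension
open Pseudofunctor.LocallyDiscreteOpToCat

variable {X : Type w} [TopologicalSpace X]

namespace PrestackHom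

variable {G H K : Gerbe.{w, v, u} X} {W V U : Opens X}

/-- The morphism of strictifications induced by a morphism of gerbes. -/
noncomputable abbrev strict (F : GerbeHom G H) : LocalGroupoid.Hom G.strict H.strict where
  obj {U} x := (F.on U).obj x
  map {W _ _ hU hV x y} f := inv (F.psi hU x) ≫ (F.on W).map f ≫ F.psi hV y
  map_id hU x := by
    rw [CategoryTheory.Functor.map_id, Category.id_comp, IsIso.inv_hom_id]
  map_comp f g := by
    rw [Functor.map_comp]
    simp only [Category.assoc, IsIso.hom_inv_id_assoc]
  map_rst {W' W U V} h {hU hV x y} f := by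
    have hf := congrArg (F.on W').map (G.map_comp_cart h f)
    rw [Functor.map_comp, Functor.map_comp] at hf
    -- After composition with `cart`, `rst` becomes the restriction functor, and the coherence
    -- `psi_comp` applies.
    rw [← cancel_epi (H.cart h hU ((F.on U).obj x)).hom]
    refine Eq.trans ?_ (H.map_comp_cart h _)
    have e₁ := psi_comp F h hU x
    have e₂ := psi_comp F h hV y
    have e₃ := psi_naturality F h f
    rw [Functor.map_comp, Functor.map_comp, Functor.map_inv, Category.assoc, Category.assoc,
      IsIso.eq_inv_comp, ← cancel_epi (F.psi h ((G.res hU).obj x)), ← reassoc_of% e₃, ← e₂,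
      ← reassoc_of% e₁, IsIso.hom_inv_id_assoc, reassoc_of% hf]

theorem strict_map_comp_psi (F : GerbeHom G H) {hU : W ≤ U} {hV : W ≤ V} {x : G.Sec U} {y : G.Sec V}
    (f : (G.res hU).obj x ⟶ (G.res hV).obj y) :
    F.psi hU x ≫ F.strict.map f = (F.on W).map f ≫ F.psi hV y := by
  simp

theorem psi_comp_hom (F : GerbeHom G H) (E : GerbeHom H K) (h : V ≤ U) (x : G.Sec U) :
    PrestackHom.psi (F ≫ E : GerbeHom G K) h x =
      (E.on V).map (F.psi h x) ≫ E.psi h ((F.on U).obj x) := by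
  change 𝟙 _ ≫ (E.on V).map (F.psi h x) ≫ 𝟙 _ ≫ E.psi h ((F.on U).obj x) ≫ 𝟙 _ = _
  simp only [Category.id_comp, Category.comp_id]

theorem strict_comp_map (F : GerbeHom G H) (E : GerbeHom H K) {hU : W ≤ U} {hV : W ≤ V}
    {x : G.Sec U} {y : G.Sec V} (f : (G.res hU).obj x ⟶ (G.res hV).obj y) :
    (PrestackHom.strict (F ≫ E : GerbeHom G K)).map (hU := hU) (hV := hV) f =
      E.strict.map (F.strict.map f) := by
  have e : (E.on W).map (F.psi hU x) ≫ E.psi hU ((F.on U).obj x) ≫ E.strict.map (F.strict.map f) =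
      (E.on W).map ((F.on W).map f) ≫ (E.on W).map (F.psi hV y) ≫ E.psi hV ((F.on V).obj y) := by
    rw [strict_map_comp_psi, ← Category.assoc, ← Functor.map_comp, strict_map_comp_psi,
      Functor.map_comp, Category.assoc]
  rw [← Category.assoc, ← psi_comp_hom, ← psi_comp_hom] at e
  exact (IsIso.inv_comp_eq _).2 e.symm

/-- The 2-morphism of strictifications induced by a 2-morphism. -/
noncomputable def strictTrans {F F' : GerbeHom G H} (m : F ⟶ F') :
    LocalGroupoid.Hom.Trans F.strict F'.strict where
  app {U} x := (H.res le_rfl).map ((m.as.app (.mk (op U))).toNatTrans.app x)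
  naturality {W U V hU hV x y} f := by
    have e (V : Opens X) (h : W ≤ V) (y : G.Sec V) :
        (m.as.app (.mk (op W))).toNatTrans.app ((G.res h).obj y) ≫ F'.psi h y =
          F.psi h y ≫ (H.res h).map ((m.as.app (.mk (op V))).toNatTrans.app y) :=
      congrArg (fun t => t.toNatTrans.app y) (m.as.naturality (homOfLE h).op.toLoc)
    change F.strict.map f ≫ H.rst hV _ _ _ = H.rst hU _ _ _ ≫ F'.strict.map f
    rw [Gerbe.rst_map, Gerbe.rst_map, ← cancel_epi (F.psi hU x), ← Category.assoc,
      strict_map_comp_psi, ← Category.assoc, Category.assoc, ← e, ← e, Category.assoc,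
      strict_map_comp_psi, ← Category.assoc, ← Category.assoc]
    exact congrArg (· ≫ F'.psi hV y) ((m.as.app (.mk (op W))).toNatTrans.naturality f)

end PrestackHom

end GerbeExtension

/-! ### From strict morphisms back to morphisms of gerbes. -/

namespace GerbeExtension
open Pseudofunctor.LocallyDiscreteOpToCat

variable {X : Type w} [TopologicalSpace X]

namespace Gerbe

variable (G : Gerbe.{w, v, u} X) {W' W V U Y : Opens X}

/-- The morphism corresponding to a morphism between restrictions to the domain. -/
def unloc {x y : G.Sec U} (f : (G.res le_rfl).obj x ⟶ (G.res le_rfl).obj y) : x ⟶ y :=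
  (G.unitor x).inv ≫ f ≫ (G.unitor y).hom

theorem unloc_id (x : G.Sec U) : G.unloc (𝟙 ((G.res le_rfl).obj x)) = 𝟙 x := by
  simp [unloc]

theorem unloc_comp {x y z : G.Sec U} (f : (G.res le_rfl).obj x ⟶ (G.res le_rfl).obj y)
    (g : (G.res le_rfl).obj y ⟶ (G.res le_rfl).obj z) :
    G.unloc (f ≫ g) = G.unloc f ≫ G.unloc g := by
  simp [unloc]

theorem unloc_map {x y : G.Sec U} (f : x ⟶ y) : G.unloc ((G.res le_rfl).map f) = f := by
  rw [unloc, unitor_naturality, Iso.inv_hom_id_assoc]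

theorem map_unloc {x y : G.Sec U} (f : (G.res le_rfl).obj x ⟶ (G.res le_rfl).obj y) :
    (G.res le_rfl).map (G.unloc f) = f := by
  rw [← cancel_mono (G.unitor y).hom, unitor_naturality, unloc, Iso.hom_inv_id_assoc]

theorem map_unloc_eq_rst (h : V ≤ U) {x y : G.Sec U}
    (f : (G.res le_rfl).obj x ⟶ (G.res le_rfl).obj y) :
    (G.res h).map (G.unloc f) = G.rst h le_rfl le_rfl f := by
  conv_rhs => rw [← G.map_unloc f, rst_map]

theorem cart_inv (h : W ≤ V) (k : V ≤ U) (x : G.Sec U) : (G.cart h k x).inv =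
    (G.toPrestack.mapComp (homOfLE k).op.toLoc (homOfLE h).op.toLoc).hom.toNatTrans.app x :=
  congrArg (fun t => t.hom.toNatTrans.app x) (Pseudofunctor.mapComp'_eq_mapComp
    G.toPrestack.toPseudofunctor (homOfLE k).op.toLoc (homOfLE h).op.toLoc)

end Gerbe

theorem comp_inv_eq_inv_comp {C : Type*} [Category* C] {p q r s t : C} (a : p ≅ q) (i : s ≅ t)
    {b : q ⟶ t} {c : p ⟶ r} {d : r ⟶ s} (e : a.hom ≫ b = c ≫ d ≫ i.hom) :
    b ≫ i.inv = a.inv ≫ c ≫ d := by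
  rw [Iso.comp_inv_eq, Category.assoc, Iso.eq_inv_comp, e, Category.assoc]

theorem comp_comp_eq_comp_id_comp {C : Type*} [Category* C] {p q r s : C} (a : p ⟶ q) (b : q ⟶ r)
    (c : r ⟶ s) : a ≫ b ≫ c = a ≫ 𝟙 _ ≫ b ≫ 𝟙 _ ≫ c ≫ 𝟙 _ := by
  simp

/-- Constructor for strong transformations of pseudofunctors on a locally discrete bicategory. -/
def StrongTrans.mkOfLocallyDiscrete {C : Type*} [Category* C] {B : Type*} [Bicategory B]
    {F G : LocallyDiscrete C ⥤ᵖ B} (app : ∀ a, F.obj a ⟶ G.obj a)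
    (naturality : ∀ {a b : LocallyDiscrete C} (f : a ⟶ b), F.map f ≫ app b ≅ app a ≫ G.map f)
    (naturality_id : ∀ a, (naturality (𝟙 a)).hom ≫ app a ◁ (G.mapId a).hom =
      (F.mapId a).hom ▷ app a ≫ (λ_ (app a)).hom ≫ (ρ_ (app a)).inv)
    (naturality_comp : ∀ {a b c : LocallyDiscrete C} (f : a ⟶ b) (g : b ⟶ c),
      (naturality (f ≫ g)).hom ≫ app a ◁ (G.mapComp f g).hom =
        (F.mapComp f g).hom ▷ app c ≫ (α_ _ _ _).hom ≫ F.map f ◁ (naturality g).hom ≫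
        (α_ _ _ _).inv ≫ (naturality f).hom ▷ G.map g ≫ (α_ _ _ _).hom) : F ⟶ G where
  app := app
  naturality := naturality
  naturality_naturality {a b f g} η := by
    obtain rfl := LocallyDiscrete.eq_of_hom η
    obtain rfl : η = 𝟙 _ := Subsingleton.elim _ _
    simp
  naturality_id := naturality_id
  naturality_comp := naturality_comp

namespace PrestackHom

variable {G H K : Gerbe.{w, v, u} X} {W V U : Opens X} (E : LocalGroupoid.Hom G.strict H.strict)

/-- The functor `G(U) ⥤ H(U)` induced by a morphism of strictifications. -/
def ofStrictFunctor (U : Opens X) : G.Sec U ⥤ H.Sec U where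
  obj x := E.obj x
  map f := H.unloc (E.map (hU := le_rfl) (hV := le_rfl) ((G.res le_rfl).map f))
  map_id x := by
    rw [CategoryTheory.Functor.map_id, ← H.unloc_id]
    exact congrArg _ (E.map_id _ _)
  map_comp f g := by
    rw [CategoryTheory.Functor.map_comp, ← H.unloc_comp]
    exact congrArg _ (E.map_comp _ _)

/-- The comparison isomorphism of a morphism of strictifications. -/
noncomputable def ofStrictPsi (h : V ≤ U) (x : G.Sec U) :
    E.obj ((G.res h).obj x) ≅ (H.res h).obj (E.obj x) :=
  (H.unitor _).symm ≪≫ asIso (E.map (hU := le_rfl) (hV := h) (G.cart le_rfl h x).hom)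

/-- Through `cart`, the relation between `f` and its restriction along `le_rfl` is an equation of
composable local morphisms, to which `E` applies. It yields the naturality of the comparison
isomorphisms and the fact that strictifying `ofStrict E` gives back `E`. -/
theorem map_ofStrict_comp_psi {hU : W ≤ U} {hV : W ≤ V} {x : G.Sec U} {y : G.Sec V}
    (f : (G.res hU).obj x ⟶ (G.res hV).obj y) :
    (ofStrictFunctor E W).map f ≫ (ofStrictPsi E hV y).hom =
      (ofStrictPsi E hU x).hom ≫ E.map f := by
  have e : (G.res le_rfl).map f ≫ (G.cart le_rfl hV y).hom = (G.cart le_rfl hU x).hom ≫ f :=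
    (G.map_comp_cart le_rfl f).trans (congrArg _ (G.strict.rst_self le_rfl f))
  have e' := congrArg (E.map (hU := le_rfl) (hV := hV)) e
  have e₁ := E.map_comp (hU := le_rfl) (hV := le_rfl) (hY := hV) ((G.res le_rfl).map f)
    (G.cart le_rfl hV y).hom
  have e₂ := E.map_comp (hU := le_rfl) (hV := hU) (hY := hV) (G.cart le_rfl hU x).hom f
  have e₃ := e₁.symm.trans (e'.trans e₂)
  simp only [ofStrictFunctor, ofStrictPsi, Iso.trans_hom, Iso.symm_hom, asIso_hom, Gerbe.unloc,
    Category.assoc, Iso.hom_inv_id_assoc]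
  rw [e₃]

theorem map_map_ofStrict (h : V ≤ U) {x y : G.Sec U} (f : x ⟶ y) :
    (H.res h).map ((ofStrictFunctor E U).map f) = E.map (hU := h) (hV := h) ((G.res h).map f) := by
  refine (H.map_unloc_eq_rst h _).trans ?_
  refine (E.map_rst h (hU := le_rfl) (hV := le_rfl) ((G.res le_rfl).map f)).symm.trans ?_
  exact congrArg (fun t => E.map (hU := h) (hV := h) t) (G.rst_map h le_rfl f)

theorem ofStrictPsi_naturality (h : V ≤ U) {x y : G.Sec U} (f : x ⟶ y) :
    (ofStrictFunctor E V).map ((G.res h).map f) ≫ (ofStrictPsi E h y).hom =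
      (ofStrictPsi E h x).hom ≫ (H.res h).map ((ofStrictFunctor E U).map f) := by
  exact (map_ofStrict_comp_psi E _).trans (congrArg (_ ≫ ·) (map_map_ofStrict E h f).symm)

theorem ofStrictPsi_rfl (x : G.Sec U) :
    (ofStrictPsi E le_rfl x).hom ≫ (H.unitor (E.obj x)).hom =
      (ofStrictFunctor E U).map (G.unitor x).hom := by
  simp only [ofStrictFunctor, ofStrictPsi, Iso.trans_hom, Iso.symm_hom, asIso_hom, Gerbe.unloc,
    Category.assoc]
  rw [← G.cart_rfl_right le_rfl]

/-- Once `map_ofStrict_comp_psi` is used, this is the image under `E` of `rst_cart`. -/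
theorem ofStrictPsi_trans (h : W ≤ V) (k : V ≤ U) (x : G.Sec U) :
    (ofStrictFunctor E W).map (G.cart h k x).hom ≫ (ofStrictPsi E (h.trans k) x).hom =
      (ofStrictPsi E h ((G.res k).obj x)).hom ≫ (H.res h).map (ofStrictPsi E k x).hom ≫
        (H.cart h k (E.obj x)).hom := by
  rw [map_ofStrict_comp_psi]
  congr 1
  have e₁ := H.map_comp_cart h (E.map (hU := le_rfl) (hV := k) (G.cart le_rfl k x).hom)
  have e₂ := E.map_rst h (hU := le_rfl) (hV := k) (G.cart le_rfl k x).hom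
  have e₃ := congrArg (fun t => E.map (hU := h) (hV := h.trans k) t) (G.rst_cart h le_rfl k x)
  have e₄ := e₂.symm.trans e₃
  simp only [ofStrictPsi, Iso.trans_hom, Iso.symm_hom, asIso_hom]
  rw [Functor.map_comp, Category.assoc, e₁, H.cart_rfl_right, ← Functor.map_comp_assoc,
    Iso.inv_hom_id, CategoryTheory.Functor.map_id, Category.id_comp]
  exact e₄.symm

theorem ofStrictPsi_trans_inv (h : W ≤ V) (k : V ≤ U) (x : G.Sec U) :
    (ofStrictPsi E (h.trans k) x).hom ≫
        (H.toPrestack.mapComp (homOfLE k).op.toLoc (homOfLE h).op.toLoc).hom.toNatTrans.app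
          (E.obj x) =
      (ofStrictFunctor E W).map
        ((G.toPrestack.mapComp (homOfLE k).op.toLoc (homOfLE h).op.toLoc).hom.toNatTrans.app x) ≫
        (ofStrictPsi E h ((G.res k).obj x)).hom ≫ (H.res h).map (ofStrictPsi E k x).hom := by
  rw [← G.cart_inv, ← H.cart_inv]
  exact comp_inv_eq_inv_comp ((ofStrictFunctor E W).mapIso (G.cart h k x))
    (H.cart h k (E.obj x)) (ofStrictPsi_trans E h k x)

/-- The morphism of gerbes induced by a morphism of strictifications. -/
noncomputable def ofStrict : GerbeHom G H :=
  StrongTrans.mkOfLocallyDiscrete (fun a => (ofStrictFunctor E a.as.unop).toCatHom)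
    (fun f => Cat.Hom.isoMk (NatIso.ofComponents (fun x => ofStrictPsi E (leOfHom f.as.unop) x)
      (fun g => ofStrictPsi_naturality E _ g)))
    (fun a => by
      ext x
      exact (ofStrictPsi_rfl E x).trans (by
        change _ = _ ≫ 𝟙 _ ≫ 𝟙 _
        simp only [Category.comp_id]
        rfl))
    (fun f g => by
      ext x
      refine (ofStrictPsi_trans_inv E (leOfHom g.as.unop) (leOfHom f.as.unop) x).trans ?_
      exact comp_comp_eq_comp_id_comp _ _ _)

theorem strict_ofStrict_map {hU : W ≤ U} {hV : W ≤ V} {x : G.Sec U} {y : G.Sec V}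
    (f : (G.res hU).obj x ⟶ (G.res hV).obj y) :
    (ofStrict E).strict.map (hU := hU) (hV := hV) f = E.map f :=
  (IsIso.inv_comp_eq _).2 (map_ofStrict_comp_psi E f)

theorem strict_map_map (F : GerbeHom G H) (h : V ≤ U) {x y : G.Sec U} (f : x ⟶ y) :
    F.strict.map (hU := h) (hV := h) ((G.res h).map f) = (H.res h).map ((F.on U).map f) :=
  (IsIso.inv_comp_eq _).2 (psi_naturality F h f)

theorem strict_map_cart (F : GerbeHom G H) (h : V ≤ U) (x : G.Sec U) :
    F.strict.map (hU := le_rfl) (hV := h) (G.cart le_rfl h x).hom =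
      (H.unitor ((F.on V).obj ((G.res h).obj x))).hom ≫ F.psi h x := by
  refine (IsIso.inv_comp_eq _).2 ?_
  rw [G.cart_rfl_left, ← psi_rfl, Category.assoc]

/-- The component of the 2-morphism induced by a 2-morphism of strictifications. -/
noncomputable def unlocTrans {F F' : GerbeHom G H}
    (η : LocalGroupoid.Hom.Trans F.strict F'.strict) (x : G.Sec U) :
    (F.on U).obj x ⟶ (F'.on U).obj x :=
  H.unloc (η.app x)

section

variable {F F' : GerbeHom G H} (η : LocalGroupoid.Hom.Trans F.strict F'.strict)

theorem map_unlocTrans (h : V ≤ U) (x : G.Sec U) :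
    (H.res h).map (unlocTrans η x) = H.rst h le_rfl le_rfl (η.app x) :=
  H.map_unloc_eq_rst h _

theorem unlocTrans_naturality {x y : G.Sec U} (f : x ⟶ y) :
    (F.on U).map f ≫ unlocTrans η y = unlocTrans η x ≫ (F'.on U).map f := by
  have e := η.naturality (hU := le_rfl) (hV := le_rfl) ((G.res le_rfl).map f)
  rw [strict_map_map, strict_map_map] at e
  have e' : (H.res le_rfl).map ((F.on U).map f ≫ unlocTrans η y) =
      (H.res le_rfl).map (unlocTrans η x ≫ (F'.on U).map f) := by
    rw [Functor.map_comp, Functor.map_comp, map_unlocTrans, map_unlocTrans]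
    exact e
  simpa only [Gerbe.unloc_map] using congrArg H.unloc e'

/-- The modification axiom is the naturality of `η` at the local morphism `cart`, which links an
object over `V` with one over `U`. -/
theorem unlocTrans_psi (h : V ≤ U) (x : G.Sec U) :
    unlocTrans η ((G.res h).obj x) ≫ F'.psi h x = F.psi h x ≫ (H.res h).map (unlocTrans η x) := by
  have e := η.naturality (hU := le_rfl) (hV := h) (G.cart le_rfl h x).hom
  rw [strict_map_cart, strict_map_cart] at e
  have e' := e.trans (congrArg (· ≫ _) (H.strict.rst_self le_rfl _))
  rw [map_unlocTrans, unlocTrans, Gerbe.unloc, Category.assoc, Category.assoc, Iso.inv_comp_eq,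
    ← Category.assoc (H.unitor _).hom]
  exact e'.symm

end

/-- The 2-isomorphism of morphisms of gerbes induced by a 2-morphism of strictifications. -/
noncomputable def isoOfStrictTrans {F F' : GerbeHom G H}
    (η : LocalGroupoid.Hom.Trans F.strict F'.strict) : F ≅ F' :=
  Pseudofunctor.StrongTrans.isoMk
    (fun a => Cat.Hom.isoMk (NatIso.ofComponents (F := F.on a.as.unop) (G := F'.on a.as.unop)
      (fun x => asIso (unlocTrans η x)) (fun f => unlocTrans_naturality η f)))
    (fun {a b} f => by
      ext x
      exact unlocTrans_psi η (leOfHom f.as.unop) x)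

theorem nonempty_iso_iff (F F' : GerbeHom G H) :
    Nonempty (F ≅ F') ↔ Nonempty (LocalGroupoid.Hom.Trans F.strict F'.strict) :=
  ⟨fun ⟨e⟩ => ⟨strictTrans e.hom⟩, fun ⟨η⟩ => ⟨isoOfStrictTrans η⟩⟩

/-- Strictification is compatible with composition. -/
noncomputable def strictComp (F : GerbeHom G H) (E : GerbeHom H K) :
    LocalGroupoid.Hom.Trans (PrestackHom.strict (F ≫ E : GerbeHom G K))
      (F.strict.comp E.strict) where
  app _ := 𝟙 _
  naturality {_ _ _ hU hV _ _} f :=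
    (congrArg (_ ≫ ·) (K.strict.rst_id hV le_rfl _)).trans ((Category.comp_id _).trans
      ((strict_comp_map F E f).trans ((Category.id_comp _).symm.trans
        (congrArg (· ≫ _) (K.strict.rst_id hU le_rfl _).symm))))

/-- The strictification of the morphism induced by a morphism of strictifications. -/
noncomputable def strictOfStrict : LocalGroupoid.Hom.Trans (ofStrict E).strict E where
  app _ := 𝟙 _
  naturality {_ _ _ hU hV _ _} f :=
    (congrArg (_ ≫ ·) (H.strict.rst_id hV le_rfl _)).trans ((Category.comp_id _).trans
      ((strict_ofStrict_map E f).trans ((Category.id_comp _).symm.trans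
        (congrArg (· ≫ _) (H.strict.rst_id hU le_rfl _).symm))))

end PrestackHom

end GerbeExtension

/-! ### Descent for gerbes as gluing of local morphisms and objects. -/

namespace GerbeExtension
open Pseudofunctor.LocallyDiscreteOpToCat

variable {X : Type w} [TopologicalSpace X]

section Conjugation

variable {C : Type*} [Category* C] {a b c d a' b' : C}

theorem iso_conj_id (i : a ≅ b) {t : b ⟶ b} (h : t = 𝟙 b) : i.hom ≫ t ≫ i.inv = 𝟙 a := by
  simp [h]

theorem iso_conj_comp (i : a ≅ a') (j : b ≅ b') (k : c ≅ d) {f : a' ⟶ b'} {g : b' ⟶ d} {h : a' ⟶ d}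
    (e : f ≫ g = h) : (i.hom ≫ f ≫ j.inv) ≫ j.hom ≫ g ≫ k.inv = i.hom ≫ h ≫ k.inv := by
  simp [← e]

/-- Turns the commuting square in a morphism of descent data, with its comparison isomorphisms, into
an equation between strictly restricted morphisms. -/
theorem comp_eq_conj_comp_iff {m₁ m₂ p : C} (i : a ≅ a') (j : b ≅ b') (k : m₁ ≅ p)
    (l : m₂ ≅ p) {φ : a' ⟶ b'} {m : a ⟶ m₁} {n : b ⟶ m₂} {r : a' ⟶ p} {s : b' ⟶ p}
    (hm : m ≫ k.hom = i.hom ≫ r) (hn : n ≫ l.hom = j.hom ≫ s) :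
    m ≫ k.hom ≫ l.inv = (i.hom ≫ φ ≫ j.inv) ≫ n ↔ φ ≫ s = r := by
  have hn' : n = j.hom ≫ s ≫ l.inv := by rw [← Category.assoc, Iso.eq_comp_inv, hn]
  rw [← Category.assoc, hm, Iso.comp_inv_eq, hn']
  simp [eq_comm]

theorem comp_eq_comp_of_eq {m₁ m₂ p : C} (i : a ≅ a') (j : b ≅ a') (k : m₁ ≅ p)
    (l : m₂ ≅ p) {m : a ⟶ m₁} {n : b ⟶ m₂} {r s : a' ⟶ p}
    (hm : m ≫ k.hom = i.hom ≫ r) (hn : n ≫ l.hom = j.hom ≫ s) (hrs : r = s) :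
    m ≫ k.hom ≫ l.inv = (i.hom ≫ j.inv) ≫ n := by
  have := (comp_eq_conj_comp_iff i j k l (φ := 𝟙 _) hm hn).2 ((Category.id_comp s).trans hrs.symm)
  rwa [Category.id_comp] at this

end Conjugation

namespace Gerbe

variable (G : Gerbe.{w, v, u} X) {W'' W' W V U Y : Opens X}

theorem ofArrows_mem {ι : Type*} {V : ι → Opens X} (hV : ∀ k, V k ≤ U)
    (cover : ∀ p ∈ U, ∃ k, p ∈ V k) :
    Sieve.ofArrows V (fun k => homOfLE (hV k)) ∈ Opens.grothendieckTopology X U := by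
  intro p hp
  obtain ⟨k, hk⟩ := cover p hp
  exact ⟨V k, homOfLE (hV k), Sieve.ofArrows_mk _ _ k, hk⟩

theorem isEquivalence_toDescentData {ι : Type*} {V : ι → Opens X} (hV : ∀ k, V k ≤ U)
    (cover : ∀ p ∈ U, ∃ k, p ∈ V k) :
    (G.toPrestack.toPseudofunctor.toDescentData (fun k => homOfLE (hV k))).IsEquivalence :=
  haveI := G.isStack
  Pseudofunctor.isEquivalence_toDescentData (J := Opens.grothendieckTopology X) _ _
    (ofArrows_mem hV cover)

theorem res_map_eq_iff (h : W' ≤ W) {hU : W ≤ U} {hV : W ≤ V} {x : G.Sec U} {y : G.Sec V}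
    (f : (G.res hU).obj x ⟶ (G.res hV).obj y)
    (g : (G.res (h.trans hU)).obj x ⟶ (G.res (h.trans hV)).obj y) :
    (G.res h).map f = (G.cart h hU x).hom ≫ g ≫ (G.cart h hV y).inv ↔ G.rst h hU hV f = g := by
  rw [← Category.assoc, Iso.eq_comp_inv, map_comp_cart, cancel_epi]

/-- Faithfulness of the comparison functor to descent data, for the cover by all opens on which the
two restrictions agree. -/
theorem strict_hom_ext {hU : W ≤ U} {hV : W ≤ V} {x : G.Sec U} {y : G.Sec V}
    (f g : (G.res hU).obj x ⟶ (G.res hV).obj y)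
    (hfg : ∀ p ∈ W, ∃ (W' : Opens X) (h : W' ≤ W), p ∈ W' ∧ G.rst h hU hV f = G.rst h hU hV g) :
    f = g := by
  let ι := {W' : Opens X // ∃ h : W' ≤ W, G.rst h hU hV f = G.rst h hU hV g}
  have := G.isEquivalence_toDescentData (U := W) (ι := ι) (V := fun k => k.1) (fun k => k.2.choose)
    (fun p hp => by
      obtain ⟨W', h, hp', e⟩ := hfg p hp
      exact ⟨⟨W', h, e⟩, hp'⟩)
  apply (G.toPrestack.toPseudofunctor.toDescentData (S := W)
    (fun k : ι => homOfLE k.2.choose)).map_injective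
  apply Pseudofunctor.DescentData.hom_ext
  intro k
  change (G.res k.2.choose).map f = (G.res k.2.choose).map g
  rw [res_map_eq_iff.{w, v, u} G _ _ (G.rst k.2.choose hU hV g) |>.2 k.2.choose_spec,
    ((G.res_map_eq_iff _ _ _).2 rfl)]

theorem rst_comp {Z : Opens X} (h : W' ≤ W) {hU : W ≤ U} {hV : W ≤ V} {hZ : W ≤ Z} {x : G.Sec U}
    {y : G.Sec V} {z : G.Sec Z} (f : (G.res hU).obj x ⟶ (G.res hV).obj y)
    (g : (G.res hV).obj y ⟶ (G.res hZ).obj z) :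
    G.rst h hU hZ (f ≫ g) = G.rst h hU hV f ≫ G.rst h hV hZ g :=
  G.strict.rst_comp h f g

theorem rst_rst (h' : W'' ≤ W') (h : W' ≤ W) {hU : W ≤ U} {hV : W ≤ V} {x : G.Sec U} {y : G.Sec V}
    (f : (G.res hU).obj x ⟶ (G.res hV).obj y) :
    G.rst h' _ _ (G.rst h hU hV f) = G.rst (h'.trans h) hU hV f :=
  G.strict.rst_rst h' h f

theorem rst_cart_inv (h' : W' ≤ W) (h : W ≤ V) (k : V ≤ U) (x : G.Sec U) :
    G.rst h' (h.trans k) h (G.cart h k x).inv = (G.cart (h'.trans h) k x).inv := by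
  have e : (G.cart h k x).inv = inv (G.cart h k x).hom := (IsIso.Iso.inv_hom _).symm
  rw [e]
  refine (G.strict.rst_inv h' (hU := h) (hV := h.trans k) _).trans ?_
  apply IsIso.inv_eq_of_hom_inv_id
  change G.rst h' h (h.trans k) (G.cart h k x).hom ≫ _ = _
  rw [rst_cart, Iso.hom_inv_id]

theorem rst_conj {V₁ V₂ U₁ U₂ : Opens X} {h₁ : V₁ ≤ U₁} {h₂ : V₂ ≤ U₂} {x : G.Sec U₁}
    {y : G.Sec U₂} {hV₁ : W ≤ V₁} {hV₂ : W ≤ V₂} (h : W' ≤ W)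
    (f : (G.res (hV₁.trans h₁)).obj x ⟶ (G.res (hV₂.trans h₂)).obj y) :
    G.rst h hV₁ hV₂ ((G.cart hV₁ h₁ x).hom ≫ f ≫ (G.cart hV₂ h₂ y).inv) =
      (G.cart (h.trans hV₁) h₁ x).hom ≫ G.rst h _ _ f ≫ (G.cart (h.trans hV₂) h₂ y).inv := by
  rw [rst_comp, rst_comp, rst_cart, rst_cart_inv]

/-- Fullness of the comparison functor. The cover is indexed by the pairs of an open set and a
morphism satisfying `R`, so `R` need not be single-valued. -/
theorem strict_hom_glue (hU : W ≤ U) (hV : W ≤ V) (x : G.Sec U) (y : G.Sec V)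
    (R : ∀ (W' : Opens X) (h : W' ≤ W),
      ((G.res (h.trans hU)).obj x ⟶ (G.res (h.trans hV)).obj y) → Prop)
    (hR : ∀ p ∈ W, ∃ (W' : Opens X) (h : W' ≤ W) (f : _), p ∈ W' ∧ R W' h f)
    (hR' : ∀ (W₁ W₂ : Opens X) (h₁ : W₁ ≤ W) (h₂ : W₂ ≤ W) (f₁ f₂ : _), R W₁ h₁ f₁ → R W₂ h₂ f₂ →
      ∀ p ∈ W₁ ⊓ W₂, ∃ (W' : Opens X) (k₁ : W' ≤ W₁) (k₂ : W' ≤ W₂),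
        p ∈ W' ∧ G.rst k₁ _ _ f₁ = G.rst k₂ _ _ f₂) :
    ∃ f : (G.res hU).obj x ⟶ (G.res hV).obj y,
      ∀ (W' : Opens X) (h : W' ≤ W) (g : _), R W' h g → G.rst h hU hV f = g := by
  let ι := Σ (W' : {W' : Opens X // W' ≤ W}),
    {f : (G.res (W'.2.trans hU)).obj x ⟶ (G.res (W'.2.trans hV)).obj y // R W'.1 W'.2 f}
  have := G.isEquivalence_toDescentData (U := W) (ι := ι) (V := fun k => k.1.1) (fun k => k.1.2)
    (fun p hp => by
      obtain ⟨W', h, f, hp', e⟩ := hR p hp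
      exact ⟨⟨⟨W', h⟩, f, e⟩, hp'⟩)
  let φ : (G.toPrestack.toPseudofunctor.toDescentData (S := W) (fun k : ι => homOfLE k.1.2)).obj
      ((G.res hU).obj x) ⟶ (G.toPrestack.toPseudofunctor.toDescentData (S := W)
        (fun k : ι => homOfLE k.1.2)).obj ((G.res hV).obj y) :=
    { hom := fun k => (G.cart k.1.2 hU x).hom ≫ k.2.1 ≫ (G.cart k.1.2 hV y).inv
      comm := fun Y q k l f₁ f₂ hf₁ hf₂ => by
        have hk := leOfHom f₁
        have hl := leOfHom f₂
        have e : G.rst hk _ _ k.2.1 = G.rst hl _ _ l.2.1 := by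
          -- `hR'` gives agreement only near each point of an overlap; separatedness extends it to
          -- all of `Y`.
          refine G.strict_hom_ext _ _ fun p hp => ?_
          obtain ⟨W', k₁, k₂, hp', e⟩ := hR' _ _ _ _ _ _ k.2.2 l.2.2 p ⟨hk hp, hl hp⟩
          refine ⟨W' ⊓ Y, inf_le_right, ⟨hp', hp⟩, ?_⟩
          have := congrArg (G.rst (inf_le_left : W' ⊓ Y ≤ W') _ _) e
          rwa [rst_rst, rst_rst] at this ⊢
        change (G.res hk).map _ ≫ (G.cart hk k.1.2 ((G.res hV).obj y)).hom ≫
          (G.cart hl l.1.2 ((G.res hV).obj y)).inv = ((G.cart hk k.1.2 ((G.res hU).obj x)).hom ≫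
            (G.cart hl l.1.2 ((G.res hU).obj x)).inv) ≫ (G.res hl).map _
        have ek := G.map_comp_cart hk (hU := k.1.2) (hV := k.1.2)
          ((G.cart k.1.2 hU x).hom ≫ k.2.1 ≫ (G.cart k.1.2 hV y).inv)
        have el := G.map_comp_cart hl (hU := l.1.2) (hV := l.1.2)
          ((G.cart l.1.2 hU x).hom ≫ l.2.1 ≫ (G.cart l.1.2 hV y).inv)
        rw [rst_conj] at ek el
        exact comp_eq_comp_of_eq _ _ _ _ ek el (by rw [e]) }
  obtain ⟨f, hf⟩ := (G.toPrestack.toPseudofunctor.toDescentData (S := W)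
    (fun k : ι => homOfLE k.1.2)).map_surjective φ
  refine ⟨f, fun W' h g hg => ?_⟩
  have e := congrArg (fun t => Pseudofunctor.DescentData.Hom.hom t ⟨⟨W', h⟩, g, hg⟩) hf
  exact (G.res_map_eq_iff _ _ _).1 e

/-- Essential surjectivity of the comparison functor, for the descent datum whose transitions are
the `φ k l` conjugated by `cart`. -/
theorem strict_obj_glue {ι : Type*} (V : ι → Opens X) (hV : ∀ k, V k ≤ U)
    (cover : ∀ p ∈ U, ∃ k, p ∈ V k) (Y : ι → Opens X) (hY : ∀ k, V k ≤ Y k) (x : ∀ k, G.Sec (Y k))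
    (φ : ∀ k l, (G.res ((inf_le_left : V k ⊓ V l ≤ V k).trans (hY k))).obj (x k) ⟶
      (G.res ((inf_le_right : V k ⊓ V l ≤ V l).trans (hY l))).obj (x l))
    (hφ : ∀ (k l m) (W : Opens X) (hk : W ≤ V k) (hl : W ≤ V l) (hm : W ≤ V m),
      G.rst (le_inf hk hl) _ _ (φ k l) ≫ G.rst (le_inf hl hm) _ _ (φ l m) =
        G.rst (le_inf hk hm) _ _ (φ k m)) :
    ∃ (y : G.Sec U) (e : ∀ k, (G.res (hY k)).obj (x k) ⟶ (G.res (hV k)).obj y),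
      ∀ k l, φ k l ≫ G.rst inf_le_right _ _ (e l) = G.rst inf_le_left _ _ (e k) := by
  let D : G.toPrestack.toPseudofunctor.DescentData (S := U) (fun k : ι => homOfLE (hV k)) :=
    { obj := fun k => (G.res (hY k)).obj (x k)
      hom := fun W q k l f₁ f₂ _ _ => (G.cart (leOfHom f₁) (hY k) (x k)).hom ≫
        G.rst (le_inf (leOfHom f₁) (leOfHom f₂)) _ _ (φ k l) ≫
          (G.cart (leOfHom f₂) (hY l) (x l)).inv
      pullHom_hom := fun W' W g q q' hq k l f₁ f₂ hf₁ hf₂ gf₁ gf₂ hgf₁ hgf₂ => by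
        refine (G.rst_conj (leOfHom g) _).trans ?_
        rw [rst_rst]
        rfl
      hom_self := fun W q k g _ => by
        have e := hφ k k k W (leOfHom g) (leOfHom g) (leOfHom g)
        -- The cocycle condition makes `φ k k` idempotent, and an idempotent in a groupoid is an
        -- identity.
        have e' : G.rst (le_inf (leOfHom g) (leOfHom g)) _ _ (φ k k) = 𝟙 _ := by
          rwa [← cancel_epi (G.rst (le_inf (leOfHom g) (leOfHom g)) _ _ (φ k k)), Category.comp_id]
        exact iso_conj_id _ e'
      hom_comp := fun W q k l m f₁ f₂ f₃ _ _ _ => by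
        exact iso_conj_comp _ _ _ (hφ k l m W (leOfHom f₁) (leOfHom f₂) (leOfHom f₃)) }
  have := G.isEquivalence_toDescentData hV cover
  let y := (G.toPrestack.toPseudofunctor.toDescentData (fun k : ι => homOfLE (hV k))).objPreimage D
  let i := ((G.toPrestack.toPseudofunctor.toDescentData
    (fun k : ι => homOfLE (hV k))).objObjPreimageIso D).inv
  refine ⟨y, i.hom, fun k l => ?_⟩
  have hk : V k ⊓ V l ≤ V k := inf_le_left
  have hl : V k ⊓ V l ≤ V l := inf_le_right
  have e := i.comm (homOfLE (hk.trans (hV k))) (homOfLE hk) (homOfLE hl) rfl rfl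
  change (G.res hk).map _ ≫ (G.cart hk (hV k) y).hom ≫ (G.cart hl (hV l) y).inv =
    ((G.cart hk (hY k) (x k)).hom ≫ G.rst (le_inf hk hl) _ _ (φ k l) ≫
      (G.cart hl (hY l) (x l)).inv) ≫ (G.res hl).map _ at e
  have ek := G.map_comp_cart hk (i.hom k)
  have el := G.map_comp_cart hl (i.hom l)
  have e' := (comp_eq_conj_comp_iff _ _ _ _ ek el).1 e
  rwa [show G.rst (le_inf hk hl) _ _ (φ k l) = φ k l from G.strict.rst_self _ _] at e'

theorem isStack_strict {X : Type v} [TopologicalSpace X] (G : Gerbe.{v, v, u} X) :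
    G.strict.IsStack where
  hom_ext := G.strict_hom_ext
  hom_glue := G.strict_hom_glue
  obj_glue := G.strict_obj_glue

end Gerbe

end GerbeExtension

/-! ### The congruence of a normal subgroupoid, and kernels. -/

namespace GerbeExtension

variable {X : Type w} [TopologicalSpace X]

namespace NormalSubgroupoid

variable {G : Gerbe.{w, v, u} X} (N : NormalSubgroupoid G) {W : Opens X}

/-- Two parallel morphisms are equivalent if they differ by an automorphism in `N`. -/
def Rel {a b : G.Sec W} (f g : a ⟶ b) : Prop := f ≫ inv g ∈ (N.on W).arrows a a

theorem rel_refl {a b : G.Sec W} (f : a ⟶ b) : N.Rel f f := by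
  rw [Rel, IsIso.hom_inv_id]
  exact (N.isNormal W).isNormal.wide a

variable {N}

theorem Rel.symm {a b : G.Sec W} {f g : a ⟶ b} (h : N.Rel f g) : N.Rel g f := by
  have := (N.on W).inv h
  rwa [Groupoid.inv_eq_inv, IsIso.inv_comp, IsIso.inv_inv] at this

theorem Rel.trans {a b : G.Sec W} {f g k : a ⟶ b} (h : N.Rel f g) (h' : N.Rel g k) :
    N.Rel f k := by
  have := (N.on W).mul h h'
  rwa [Category.assoc, IsIso.inv_hom_id_assoc] at this

theorem conj_mem {a b : G.Sec W} (p : b ⟶ a) {n : a ⟶ a} (h : n ∈ (N.on W).arrows a a) :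
    p ≫ n ≫ inv p ∈ (N.on W).arrows b b := by
  have := (N.isNormal W).isNormal.conj (inv p) h
  rwa [Groupoid.inv_eq_inv, IsIso.inv_inv] at this

/-- Normality enters through `f f' (g g')⁻¹ = (f (f' g'⁻¹) f⁻¹) (f g⁻¹)`. -/
theorem Rel.comp {a b c : G.Sec W} {f g : a ⟶ b} {f' g' : b ⟶ c} (h : N.Rel f g)
    (h' : N.Rel f' g') : N.Rel (f ≫ f') (g ≫ g') := by
  have := (N.on W).mul (conj_mem f h') h
  simpa [Rel] using this

theorem Rel.rst {W' U V : Opens X} {hU : W ≤ U} {hV : W ≤ V} {x : G.Sec U} {y : G.Sec V}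
    {f g : (G.res hU).obj x ⟶ (G.res hV).obj y} (h : N.Rel f g) (k : W' ≤ W) :
    N.Rel (G.rst k hU hV f) (G.rst k hU hV g) := by
  have := conj_mem (G.cart k hU x).inv (N.res_mem k _ _ h)
  have e (f) : G.rst k hU hV f = (G.cart k hU x).inv ≫ (G.res k).map f ≫ (G.cart k hV y).hom := by
    rw [Iso.eq_inv_comp, G.map_comp_cart]
  rw [Rel, e, e]
  simpa using this

/-- This is the sheaf condition on `N`, applied to `f ≫ inv g` after conjugation by `cart`. -/
theorem rel_of_rst {U V : Opens X} {hU : W ≤ U} {hV : W ≤ V} {x : G.Sec U} {y : G.Sec V}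
    {f g : (G.res hU).obj x ⟶ (G.res hV).obj y} (h : ∀ p ∈ W, ∃ (W' : Opens X) (k : W' ≤ W),
      p ∈ W' ∧ N.Rel (G.rst k hU hV f) (G.rst k hU hV g)) : N.Rel f g := by
  refine N.isSheaf _ _ _ fun p hp => ?_
  obtain ⟨W', k, hp', e⟩ := h p hp
  refine ⟨W', k, hp', ?_⟩
  have e' (f) : G.rst k hU hV f = (G.cart k hU x).inv ≫ (G.res k).map f ≫ (G.cart k hV y).hom := by
    rw [Iso.eq_inv_comp, G.map_comp_cart]
  rw [Rel, e', e'] at e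
  have := conj_mem (G.cart k hU x).hom e
  simpa using this

theorem Rel.map {G' : Gerbe.{w, v, u} X} {N' : NormalSubgroupoid G'} {D : GerbeHom G G'}
    (hD : MapsInto D N N') {a b : G.Sec W} {f g : a ⟶ b} (h : N.Rel f g) :
    N'.Rel ((D.on W).map f) ((D.on W).map g) := by
  have := hD _ _ _ h
  rwa [Functor.map_comp, Functor.map_inv] at this

end NormalSubgroupoid

variable {G H : Gerbe.{w, v, u} X} {N : NormalSubgroupoid G} {F : GerbeHom G H}

theorem IsExtension.rel_iff (hF : IsExtension N F) {W : Opens X} {a b : G.Sec W} (f g : a ⟶ b) :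
    N.Rel f g ↔ (F.on W).map f = (F.on W).map g := by
  rw [NormalSubgroupoid.Rel, hF.eq_kernel, mem_kernel_iff, Functor.map_comp, Functor.map_inv,
    IsIso.comp_inv_eq, Category.id_comp]

theorem PrestackHom.strict_map_eq_iff (F : GerbeHom G H) {W U V : Opens X} {hU : W ≤ U} {hV : W ≤ V}
    {x : G.Sec U} {y : G.Sec V} (f g : (G.res hU).obj x ⟶ (G.res hV).obj y) :
    F.strict.map (hU := hU) (hV := hV) f = F.strict.map (hU := hU) (hV := hV) g ↔
      (F.on W).map f = (F.on W).map g := by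
  simp [cancel_mono]

theorem IsWeakEpi.strict (hF : IsWeakEpi F) : F.strict.IsWeakEpi where
  exists_obj {U} q p hp := by
    obtain ⟨V, h, i, hp', ⟨e⟩⟩ := hF.locally_surj_obj U q p hp
    exact ⟨V, h, i, hp', ⟨(H.unitor _).hom ≫ e.hom⟩⟩
  exists_map {W U V hU hV x y} f p hp := by
    -- Surjectivity is applied to the objects already restricted to `W`; `psi` moves the target
    -- morphism between their images, and `cart` then corrects the iterated restrictions.
    obtain ⟨W', k, g, hp', e⟩ := hF.surj_iso W ((G.res hU).obj x) ((G.res hV).obj y)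
      (F.psi hU x ≫ f ≫ inv (F.psi hV y)) p hp
    refine ⟨W', k, (G.cart k hU x).inv ≫ g ≫ (G.cart k hV y).hom, hp', ?_⟩
    rw [IsIso.inv_comp_eq]
    have e₁ := F.psi_comp k hU x
    have e₂ := F.psi_comp k hV y
    have e₃ := H.map_comp_cart k f
    rw [Functor.map_comp, Functor.map_comp, Functor.map_inv, ← Category.assoc, ← Category.assoc,
      IsIso.eq_comp_inv, Category.assoc, Category.assoc] at e
    rw [Functor.map_comp, Functor.map_comp, Category.assoc, Category.assoc, e₂, reassoc_of% e, e₃,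
      ← reassoc_of% e₁, ← Functor.map_comp_assoc, Iso.inv_hom_id, CategoryTheory.Functor.map_id,
      Category.id_comp]

end GerbeExtension

/-! ### Stalks of a quotient by a congruence. -/

namespace GerbeExtension

namespace LocalGroupoid

variable {X : Type v} [TopologicalSpace X]

/-- A congruence on the morphisms of `S`, of local nature. -/
structure Congruence (S : LocalGroupoid.{v, v, u} X) where
  /-- the relation -/
  r {W U V : Opens X} {hU : W ≤ U} {hV : W ≤ V} {x : S.Ob U} {y : S.Ob V}
    (f g : S.pt hU x ⟶ S.pt hV y) : Prop
  refl {W U V : Opens X} {hU : W ≤ U} {hV : W ≤ V} {x : S.Ob U} {y : S.Ob V}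
    (f : S.pt hU x ⟶ S.pt hV y) : r f f
  symm {W U V : Opens X} {hU : W ≤ U} {hV : W ≤ V} {x : S.Ob U} {y : S.Ob V}
    {f g : S.pt hU x ⟶ S.pt hV y} : r f g → r g f
  trans {W U V : Opens X} {hU : W ≤ U} {hV : W ≤ V} {x : S.Ob U} {y : S.Ob V}
    {f g k : S.pt hU x ⟶ S.pt hV y} : r f g → r g k → r f k
  comp {W U V Y : Opens X} {hU : W ≤ U} {hV : W ≤ V} {hY : W ≤ Y} {x : S.Ob U} {y : S.Ob V}
    {z : S.Ob Y} {f f' : S.pt hU x ⟶ S.pt hV y} {g g' : S.pt hV y ⟶ S.pt hY z} :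
    r f f' → r g g' → r (f ≫ g) (f' ≫ g')
  rst {W' W U V : Opens X} (k : W' ≤ W) {hU : W ≤ U} {hV : W ≤ V} {x : S.Ob U} {y : S.Ob V}
    {f g : S.pt hU x ⟶ S.pt hV y} : r f g → r (S.rst k f) (S.rst k g)
  of_rst {W U V : Opens X} {hU : W ≤ U} {hV : W ≤ V} {x : S.Ob U} {y : S.Ob V}
    {f g : S.pt hU x ⟶ S.pt hV y} : (∀ p ∈ W, ∃ (W' : Opens X) (k : W' ≤ W), p ∈ W' ∧
      r (S.rst k f) (S.rst k g)) → r f g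

namespace Congruence

variable {S : LocalGroupoid.{v, v, u} X} (c : S.Congruence)

/-- A morphism defined near a point. -/
structure GermRep (z : X) {U V : Opens X} (x : S.Ob U) (y : S.Ob V) where
  /-- the domain of definition -/
  dom : Opens X
  mem : z ∈ dom
  left : dom ≤ U
  right : dom ≤ V
  /-- the morphism -/
  hom : S.pt left x ⟶ S.pt right y

/-- Two morphisms defined near a point are equivalent if they are related near this point. -/
def germSetoid (z : X) {U V : Opens X} (x : S.Ob U) (y : S.Ob V) : Setoid (GermRep z x y) where
  r f g := ∃ (W : Opens X) (h : W ≤ f.dom) (k : W ≤ g.dom), z ∈ W ∧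
    c.r (S.rst h f.hom) (S.rst k g.hom)
  iseqv :=
    { refl f := ⟨f.dom, le_rfl, le_rfl, f.mem, c.refl _⟩
      symm := fun ⟨W, h, k, hz, e⟩ => ⟨W, k, h, hz, c.symm e⟩
      trans := by
        rintro f g l ⟨W, h, k, hz, e⟩ ⟨W', h', k', hz', e'⟩
        refine ⟨W ⊓ W', inf_le_left.trans h, inf_le_right.trans k', ⟨hz, hz'⟩, ?_⟩
        have i := c.rst (inf_le_left : W ⊓ W' ≤ W) e
        have i' := c.rst (inf_le_right : W ⊓ W' ≤ W') e'
        simp only [rst_rst] at i i'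
        exact c.trans i i' }

/-- The objects of the stalk at `z`. -/
structure Stalk (c : S.Congruence) (z : X) where
  /-- the domain of definition -/
  dom : Opens X
  mem : z ∈ dom
  /-- the object -/
  obj : S.Ob dom

/-- The germ of an object. -/
abbrev st {z : X} {U : Opens X} (hz : z ∈ U) (x : S.Ob U) : c.Stalk z := ⟨U, hz, x⟩

instance (z : X) : CategoryStruct (c.Stalk z) where
  Hom x y := Quotient (c.germSetoid z x.obj y.obj)
  id x := Quotient.mk _ ⟨x.dom, x.mem, le_rfl, le_rfl, 𝟙 _⟩
  comp f g := Quotient.map₂ (fun f g => ⟨f.dom ⊓ g.dom, ⟨f.mem, g.mem⟩, inf_le_left.trans f.left,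
    inf_le_right.trans g.right, S.rst (hV := f.right) inf_le_left f.hom ≫
      S.rst (hU := g.left) inf_le_right g.hom⟩) (by
        rintro f f' ⟨W, h, k, hz, e⟩ g g' ⟨W', h', k', hz', e'⟩
        refine ⟨W ⊓ W', inf_le_inf h h', inf_le_inf k k', ⟨hz, hz'⟩, ?_⟩
        have i := c.rst (inf_le_left : W ⊓ W' ≤ W) e
        have i' := c.rst (inf_le_right : W ⊓ W' ≤ W') e'
        simp only [rst_rst] at i i'
        simp only [rst_comp, rst_rst]
        exact c.comp i i') f g

variable {c}

/-- The germ of a morphism. -/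
def germ {z : X} {W U V : Opens X} (hz : z ∈ W) {hU : W ≤ U} {hV : W ≤ V} {x : S.Ob U} {y : S.Ob V}
    (f : S.pt hU x ⟶ S.pt hV y) : c.st (hU hz) x ⟶ c.st (hV hz) y :=
  Quotient.mk _ ⟨W, hz, hU, hV, f⟩

theorem exists_germ {z : X} {U V : Opens X} {hz : z ∈ U} {hz' : z ∈ V} {x : S.Ob U} {y : S.Ob V}
    (φ : c.st hz x ⟶ c.st hz' y) : ∃ (W : Opens X) (hW : z ∈ W) (hU : W ≤ U) (hV : W ≤ V)
      (f : S.pt hU x ⟶ S.pt hV y), germ hW f = φ := by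
  obtain ⟨f, rfl⟩ := Quotient.exists_rep φ
  exact ⟨f.dom, f.mem, f.left, f.right, f.hom, rfl⟩

theorem germ_eq_iff {z : X} {W W' U V : Opens X} {hz : z ∈ W} {hz' : z ∈ W'} {hU : W ≤ U}
    {hV : W ≤ V} {hU' : W' ≤ U} {hV' : W' ≤ V} {x : S.Ob U} {y : S.Ob V}
    {f : S.pt hU x ⟶ S.pt hV y} {g : S.pt hU' x ⟶ S.pt hV' y} :
    (germ hz f : c.st _ x ⟶ c.st _ y) = germ hz' g ↔
      ∃ (W'' : Opens X) (h : W'' ≤ W) (k : W'' ≤ W'), z ∈ W'' ∧ c.r (S.rst h f) (S.rst k g) :=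
  Quotient.eq (r := c.germSetoid z x y)

theorem germ_rst {z : X} {W' W U V : Opens X} (hz : z ∈ W') (h : W' ≤ W) {hU : W ≤ U} {hV : W ≤ V}
    {x : S.Ob U} {y : S.Ob V} (f : S.pt hU x ⟶ S.pt hV y) :
    (germ hz (S.rst h f) : c.st _ x ⟶ c.st _ y) = germ (h hz) f :=
  germ_eq_iff.2 ⟨W', le_rfl, h, hz, by simpa using c.refl _⟩

theorem germ_comp {z : X} {W U V Y : Opens X} (hz : z ∈ W) {hU : W ≤ U} {hV : W ≤ V} {hY : W ≤ Y}
    {x : S.Ob U} {y : S.Ob V} {t : S.Ob Y} (f : S.pt hU x ⟶ S.pt hV y) (g : S.pt hV y ⟶ S.pt hY t) :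
    (germ hz (f ≫ g) : c.st _ x ⟶ c.st _ t) = germ hz f ≫ germ hz g :=
  germ_eq_iff.2 ⟨W, le_rfl, le_inf le_rfl le_rfl, hz, by simpa using c.refl _⟩

theorem germ_id {z : X} {W U : Opens X} (hz : z ∈ W) (hU : W ≤ U) (x : S.Ob U) :
    (germ hz (𝟙 (S.pt hU x)) : c.st _ x ⟶ c.st _ x) = 𝟙 _ :=
  germ_eq_iff.2 ⟨W, le_rfl, hU, hz, by simpa using c.refl _⟩

noncomputable instance (z : X) : Groupoid (c.Stalk z) where
  id_comp {x y} φ := by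
    obtain ⟨W, hW, hU, hV, f, rfl⟩ := exists_germ (c := c) φ
    rw [← germ_id hW hU, ← germ_comp, Category.id_comp]
  comp_id {x y} φ := by
    obtain ⟨W, hW, hU, hV, f, rfl⟩ := exists_germ (c := c) φ
    rw [← germ_id hW hV, ← germ_comp, Category.comp_id]
  assoc {x y t s} φ ψ χ := by
    obtain ⟨W, hW, hU, hV, f, rfl⟩ := exists_germ (c := c) φ
    obtain ⟨W₁, hW₁, hU₁, hV₁, g, rfl⟩ := exists_germ (c := c) ψ
    obtain ⟨W₂, hW₂, hU₂, hV₂, k, rfl⟩ := exists_germ (c := c) χ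
    have h : W ⊓ W₁ ⊓ W₂ ≤ W := inf_le_left.trans inf_le_left
    have h₁ : W ⊓ W₁ ⊓ W₂ ≤ W₁ := inf_le_left.trans inf_le_right
    have h₂ : W ⊓ W₁ ⊓ W₂ ≤ W₂ := inf_le_right
    have hz : z ∈ W ⊓ W₁ ⊓ W₂ := ⟨⟨hW, hW₁⟩, hW₂⟩
    rw [← germ_rst hz h, ← germ_rst hz h₁, ← germ_rst hz h₂]
    simp only [← germ_comp, Category.assoc]
  inv {x y} := Quotient.map (fun f => ⟨f.dom, f.mem, f.right, f.left, inv f.hom⟩) (by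
    rintro f g ⟨W, h, k, hz, e⟩
    refine ⟨W, h, k, hz, ?_⟩
    have e' := c.comp (c.comp (c.refl (inv (S.rst h f.hom))) e) (c.refl (inv (S.rst k g.hom)))
    simpa using c.symm e')
  inv_comp {x y} φ := by
    obtain ⟨W, hW, hU, hV, f, rfl⟩ := exists_germ (c := c) φ
    exact (germ_comp hW (inv f) f).symm.trans (by rw [IsIso.inv_hom_id, germ_id])
  comp_inv {x y} φ := by
    obtain ⟨W, hW, hU, hV, f, rfl⟩ := exists_germ (c := c) φ
    exact (germ_comp hW f (inv f)).symm.trans (by rw [IsIso.hom_inv_id, germ_id])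

theorem germ_inv {z : X} {W U V : Opens X} (hz : z ∈ W) {hU : W ≤ U} {hV : W ≤ V} {x : S.Ob U}
    {y : S.Ob V} (f : S.pt hU x ⟶ S.pt hV y) :
    (germ hz (inv f) : c.st _ y ⟶ c.st _ x) = inv (germ hz f) :=
  Groupoid.inv_eq_inv (germ hz f)

/-- Germs detect the congruence because the congruence is local; this lets pointwise families
represent morphisms of the quotient. -/
theorem r_of_germ_eq {W U V : Opens X} {hU : W ≤ U} {hV : W ≤ V} {x : S.Ob U} {y : S.Ob V}
    {f g : S.pt hU x ⟶ S.pt hV y}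
    (h : ∀ (z : X) (hz : z ∈ W), (germ hz f : c.st _ x ⟶ c.st _ y) = germ hz g) : c.r f g := by
  refine c.of_rst fun z hz => ?_
  obtain ⟨W', k, k', hz', e⟩ := germ_eq_iff.1 (h z hz)
  exact ⟨W', k, hz', e⟩

theorem germ_eq_of_r {W U V : Opens X} {hU : W ≤ U} {hV : W ≤ V} {x : S.Ob U} {y : S.Ob V}
    {f g : S.pt hU x ⟶ S.pt hV y} (h : c.r f g) {z : X} (hz : z ∈ W) :
    (germ hz f : c.st _ x ⟶ c.st _ y) = germ hz g :=
  germ_eq_iff.2 ⟨W, le_rfl, le_rfl, hz, by simpa using h⟩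

end Congruence

end LocalGroupoid

end GerbeExtension

/-! ### Atlases, and the gluing of atlases. -/

namespace GerbeExtension

namespace LocalGroupoid.Congruence

variable {X : Type v} [TopologicalSpace X] {S : LocalGroupoid.{v, v, u} X} {c : S.Congruence}

/-- A chart: a local object with trivializations of its germs, relative to a choice `o` of an object
in each stalk. -/
structure Chart (o : ∀ z, c.Stalk z) where
  /-- the domain of the chart -/
  dom : Opens X
  /-- the domain of the object -/
  obDom : Opens X
  le : dom ≤ obDom
  /-- the local object -/
  obj : S.Ob obDom
  /-- the trivialization of the germs -/
  triv (z : X) (hz : z ∈ dom) : c.st (le hz) obj ⟶ o z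

/-- Families of automorphisms of the chosen objects of the stalks. -/
abbrev Family (o : ∀ z, c.Stalk z) (U : Opens X) := ∀ z ∈ U, (o z ⟶ o z)

variable {o : ∀ z, c.Stalk z} {U V W : Opens X}

/-- Continuity at `z` of a family of automorphisms, relative to two charts. -/
def IsCont (α β : Chart o) (φ : Family o U) (z : X) : Prop :=
  ∃ (W : Opens X) (hα : W ≤ α.dom) (hβ : W ≤ β.dom) (hU : W ≤ U)
    (f : S.pt (hα.trans α.le) α.obj ⟶ S.pt (hβ.trans β.le) β.obj), z ∈ W ∧
      ∀ (w : X) (hw : w ∈ W), germ hw f ≫ β.triv w (hβ hw) = α.triv w (hα hw) ≫ φ w (hU hw)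

theorem IsCont.one (α : Chart o) {z : X} (hz : z ∈ α.dom) (hU : z ∈ U) :
    IsCont α α (fun w (_ : w ∈ U) => 𝟙 (o w)) z :=
  ⟨α.dom ⊓ U, inf_le_left, inf_le_left, inf_le_right, 𝟙 _, ⟨hz, hU⟩, fun w hw => by
    rw [germ_id hw, Category.id_comp, Category.comp_id]⟩

theorem IsCont.comp {α β γ : Chart o} {φ ψ : Family o U} {z : X} (h : IsCont α β φ z)
    (h' : IsCont β γ ψ z) : IsCont α γ (fun w hw => φ w hw ≫ ψ w hw) z := by
  obtain ⟨W, hα, hβ, hU, f, hz, e⟩ := h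
  obtain ⟨W', hβ', hγ, hU', f', hz', e'⟩ := h'
  refine ⟨W ⊓ W', inf_le_left.trans hα, inf_le_right.trans hγ, inf_le_left.trans hU,
    S.rst inf_le_left f ≫ S.rst inf_le_right f', ⟨hz, hz'⟩, fun w hw => ?_⟩
  rw [germ_comp hw, germ_rst, germ_rst, Category.assoc, e' w hw.2, reassoc_of% e w hw.1]

theorem IsCont.inv {α β : Chart o} {φ : Family o U} {z : X} (h : IsCont α β φ z) :
    IsCont β α (fun w hw => CategoryTheory.inv (φ w hw)) z := by
  obtain ⟨W, hα, hβ, hU, f, hz, e⟩ := h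
  refine ⟨W, hβ, hα, hU, CategoryTheory.inv f, hz, fun w hw => ?_⟩
  rw [germ_inv hw, IsIso.inv_comp_eq, ← Category.assoc, IsIso.eq_comp_inv, e]

theorem IsCont.congr {α β : Chart o} {φ : Family o U} {ψ : Family o V} {z : X} (h : IsCont α β φ z)
    (hz : z ∈ W) (hU : W ≤ U) (hV : W ≤ V) (hφ : ∀ w (hw : w ∈ W), φ w (hU hw) = ψ w (hV hw)) :
    IsCont α β ψ z := by
  obtain ⟨W', hα, hβ, hU', f, hz', e⟩ := h
  refine ⟨W' ⊓ W, inf_le_left.trans hα, inf_le_left.trans hβ, inf_le_right.trans hV,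
    S.rst inf_le_left f, ⟨hz', hz⟩, fun w hw => ?_⟩
  rw [germ_rst, e w hw.1, ← hφ w hw.2]

/-- An object of the quotient: a compatible family of charts that covers an open set. -/
structure Atlas (o : ∀ z, c.Stalk z) (U : Opens X) where
  /-- the charts -/
  charts : Set (Chart o)
  cover : ∀ z ∈ U, ∃ α ∈ charts, z ∈ α.dom
  compat : ∀ α ∈ charts, ∀ β ∈ charts, ∀ z ∈ U, z ∈ α.dom → z ∈ β.dom →
    IsCont α β (fun w (_ : w ∈ U) => 𝟙 (o w)) z

/-- A morphism of the quotient: a continuous family of automorphisms. -/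
@[ext]
structure Atlas.Hom (A B : Atlas o U) where
  /-- the family of automorphisms -/
  fam : Family o U
  cont : ∀ α ∈ A.charts, ∀ β ∈ B.charts, ∀ z ∈ U, z ∈ α.dom → z ∈ β.dom → IsCont α β fam z

instance : Category.{v} (Atlas o U) where
  Hom := Atlas.Hom
  id A := ⟨fun w _ => 𝟙 (o w), A.compat⟩
  comp {A B C} φ ψ := ⟨fun w hw => φ.fam w hw ≫ ψ.fam w hw, fun α hα γ hγ z hz hzα hzγ => by
    obtain ⟨β, hβ, hzβ⟩ := B.cover z hz
    exact (φ.cont α hα β hβ z hz hzα hzβ).comp (ψ.cont β hβ γ hγ z hz hzβ hzγ)⟩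
  id_comp φ := Atlas.Hom.ext (funext fun w => funext fun _ => Category.id_comp _)
  comp_id φ := Atlas.Hom.ext (funext fun w => funext fun _ => Category.comp_id _)
  assoc φ ψ χ := Atlas.Hom.ext (funext fun w => funext fun _ => Category.assoc _ _ _)

namespace Atlas

@[ext]
theorem hom_ext {A B : Atlas o U} {φ ψ : A ⟶ B} (h : ∀ w hw, φ.fam w hw = ψ.fam w hw) : φ = ψ :=
  Hom.ext (funext fun w => funext fun hw => h w hw)

@[simp]
theorem id_fam (A : Atlas o U) (w : X) (hw : w ∈ U) : (𝟙 A : A ⟶ A).fam w hw = 𝟙 _ := rfl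

@[simp]
theorem comp_fam {A B C : Atlas o U} (φ : A ⟶ B) (ψ : B ⟶ C) (w : X) (hw : w ∈ U) :
    (φ ≫ ψ).fam w hw = φ.fam w hw ≫ ψ.fam w hw := rfl

instance : IsGroupoid (Atlas o U) where
  all_isIso {A B} φ := ⟨⟨fun w hw => CategoryTheory.inv (φ.fam w hw), fun α hα β hβ z hz hzα hzβ =>
    (φ.cont β hβ α hα z hz hzβ hzα).inv⟩, by ext; exact IsIso.hom_inv_id _,
      by ext; exact IsIso.inv_hom_id _⟩

/-- Restriction of atlases. -/
def res (h : V ≤ U) : Atlas o U ⥤ Atlas o V where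
  obj A := ⟨A.charts, fun z hz => A.cover z (h hz), fun α hα β hβ z hz hzα hzβ =>
    (A.compat α hα β hβ z (h hz) hzα hzβ).congr hz h le_rfl fun _ _ => rfl⟩
  map φ := ⟨fun w hw => φ.fam w (h hw), fun α hα β hβ z hz hzα hzβ =>
    (φ.cont α hα β hβ z (h hz) hzα hzβ).congr hz h le_rfl fun _ _ => rfl⟩

/-- The value at a point is read off from any member of the cover containing it; continuity is a
local condition. -/
theorem hom_glue {ι : Type*} {V : ι → Opens X} (hV : ∀ k, V k ≤ U)
    (cover : ∀ p ∈ U, ∃ k, p ∈ V k) (A B : Atlas o U)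
    (φ : ∀ k, (res (hV k)).obj A ⟶ (res (hV k)).obj B)
    (hφ : ∀ k l w (hk : w ∈ V k) (hl : w ∈ V l), (φ k).fam w hk = (φ l).fam w hl) :
    ∃ ψ : A ⟶ B, ∀ k, (res (hV k)).map ψ = φ k := by
  choose κ hκ using cover
  refine ⟨⟨fun w hw => (φ (κ w hw)).fam w (hκ w hw), fun α hα β hβ z hz hzα hzβ => ?_⟩, fun k => ?_⟩
  · exact ((φ (κ z hz)).cont α hα β hβ z (hκ z hz) hzα hzβ).congr (hκ z hz) le_rfl (hV _)
      fun w hw => hφ _ _ _ _ _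
  · ext w hw
    exact hφ _ _ _ _ _

theorem obj_glue {ι : Type*} {V : ι → Opens X} (hV : ∀ k, V k ≤ U)
    (cover : ∀ p ∈ U, ∃ k, p ∈ V k) (A : ∀ k, Atlas o (V k))
    (φ : ∀ k l, (res (inf_le_left : V k ⊓ V l ≤ V k)).obj (A k) ⟶ (res inf_le_right).obj (A l))
    (hφ : ∀ (k l m) (w : X) (hk : w ∈ V k) (hl : w ∈ V l) (hm : w ∈ V m),
      (φ k l).fam w ⟨hk, hl⟩ ≫ (φ l m).fam w ⟨hl, hm⟩ = (φ k m).fam w ⟨hk, hm⟩) :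
    ∃ (B : Atlas o U) (e : ∀ k, A k ⟶ (res (hV k)).obj B),
      ∀ k l w (hk : w ∈ V k) (hl : w ∈ V l),
        (φ k l).fam w ⟨hk, hl⟩ ≫ (e l).fam w hl = (e k).fam w hk := by
  choose κ hκ using cover
  -- For each point `z` an index `κ z` is chosen, and every trivialization at `z` is transported to
  -- that index by the gluing data. The choice varies arbitrarily with `z`, but by the cocycle
  -- condition it cancels in all changes of charts.
  let ch (k : ι) (α : Chart o) : Chart o :=
    { dom := α.dom ⊓ V k
      obDom := α.obDom
      le := inf_le_left.trans α.le
      obj := α.obj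
      triv z hz := α.triv z hz.1 ≫ (φ k (κ z (hV k hz.2))).fam z ⟨hz.2, hκ _ _⟩ }
  have key : ∀ k l, ∀ α ∈ (A k).charts, ∀ β ∈ (A l).charts, ∀ z (hk : z ∈ V k) (hl : z ∈ V l),
      z ∈ α.dom → z ∈ β.dom → ∃ (W : Opens X) (hα : W ≤ α.dom) (hβ : W ≤ β.dom) (hk : W ≤ V k)
        (hl : W ≤ V l)
        (f : S.pt (hα.trans α.le) α.obj ⟶ S.pt (hβ.trans β.le) β.obj), z ∈ W ∧
        ∀ (w : X) (hw : w ∈ W), germ hw f ≫ (ch l β).triv w ⟨hβ hw, hl hw⟩ =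
          (ch k α).triv w ⟨hα hw, hk hw⟩ := by
    intro k l α hα β hβ z hk hl hzα hzβ
    obtain ⟨W, hWα, hWβ, hW, f, hz, e⟩ := (φ k l).cont α hα β hβ z ⟨hk, hl⟩ hzα hzβ
    refine ⟨W, hWα, hWβ, hW.trans inf_le_left, hW.trans inf_le_right, f, hz, fun w hw => ?_⟩
    change germ hw f ≫ β.triv w _ ≫ _ = α.triv w _ ≫ _
    rw [← Category.assoc, e w hw, Category.assoc,
      hφ k l _ w (hW hw).1 (hW hw).2 (hκ _ _)]
  refine ⟨⟨{γ | ∃ (k : ι), ∃ α ∈ (A k).charts, γ = ch k α}, ?_, ?_⟩, fun k => ⟨fun w hw =>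
    (φ k (κ w (hV k hw))).fam w ⟨hw, hκ _ _⟩, ?_⟩, fun k l w hk hl => hφ k l _ w hk hl (hκ _ _)⟩
  · intro z hz
    obtain ⟨α, hα, hzα⟩ := (A (κ z hz)).cover z (hκ z hz)
    exact ⟨ch _ α, ⟨_, α, hα, rfl⟩, hzα, hκ z hz⟩
  · rintro _ ⟨k, α, hα, rfl⟩ _ ⟨l, β, hβ, rfl⟩ z hz ⟨hzα, hzk⟩ ⟨hzβ, hzl⟩
    obtain ⟨W, hWα, hWβ, hk, hl, f, hzW, e⟩ := key k l α hα β hβ z hzk hzl hzα hzβ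
    exact ⟨W, le_inf hWα hk, le_inf hWβ hl, hk.trans (hV k), f, hzW, fun w hw =>
      (e w hw).trans (Category.comp_id _).symm⟩
  · rintro α hα _ ⟨l, β, hβ, rfl⟩ z hz hzα ⟨hzβ, hzl⟩
    obtain ⟨W, hWα, hWβ, hk, hl, f, hzW, e⟩ := key k l α hα β hβ z hz hzl hzα hzβ
    exact ⟨W, hWα, le_inf hWβ hl, hk, f, hzW, e⟩

end Atlas

end LocalGroupoid.Congruence

end GerbeExtension

namespace GerbeExtension

/-! ### The stack of atlases. -/

open Pseudofunctor.LocallyDiscreteOpToCat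

namespace LocalGroupoid.Congruence

variable {X : Type v} [TopologicalSpace X] {S : LocalGroupoid.{v, v, u} X} {c : S.Congruence}
  (o : ∀ z, c.Stalk z)

/-- The prestack of atlases. -/
def prestack : Prestack.{v, v, max u v} X :=
  { pseudofunctorOfIsLocallyDiscrete (B := LocallyDiscrete (Opens X)ᵒᵖ) (C := Cat.{v, max u v})
      (fun a => Cat.of (Atlas o a.as.unop)) (fun f => (Atlas.res (leOfHom f.as.unop)).toCatHom)
      (fun _ => Iso.refl _) (fun _ _ => Iso.refl _)
      (fun f g h => by
        ext A
        refine Atlas.hom_ext fun w hw => ?_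
        change 𝟙 (o w) ≫ 𝟙 (o w) ≫ 𝟙 (o w) ≫ 𝟙 (o w) ≫ 𝟙 (o w) = 𝟙 (o w)
        simp only [Category.comp_id])
      (fun f => by
        ext A
        refine Atlas.hom_ext fun w hw => ?_
        change 𝟙 (o w) ≫ 𝟙 (o w) ≫ 𝟙 (o w) = 𝟙 (o w)
        simp only [Category.comp_id])
      (fun f => by
        ext A
        refine Atlas.hom_ext fun w hw => ?_
        change 𝟙 (o w) ≫ 𝟙 (o w) ≫ 𝟙 (o w) = 𝟙 (o w)
        simp only [Category.comp_id]) with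
    map_id := fun _ => rfl
    mapId_eq_eqToIso := fun _ => rfl }

variable {o} {U V W : Opens X}

theorem mapComp'_hom_fam {a b d : LocallyDiscrete (Opens X)ᵒᵖ} (f : a ⟶ b) (g : b ⟶ d) (fg : a ⟶ d)
    (h : f ≫ g = fg) (A : Atlas o a.as.unop) (w : X) (hw : w ∈ d.as.unop) :
    Atlas.Hom.fam (((prestack o).mapComp' f g fg h).hom.toNatTrans.app A) w hw = 𝟙 _ := by
  subst h
  rw [Pseudofunctor.mapComp'_eq_mapComp]
  rfl

theorem mapComp'_inv_fam {a b d : LocallyDiscrete (Opens X)ᵒᵖ} (f : a ⟶ b) (g : b ⟶ d) (fg : a ⟶ d)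
    (h : f ≫ g = fg) (A : Atlas o a.as.unop) (w : X) (hw : w ∈ d.as.unop) :
    Atlas.Hom.fam (((prestack o).mapComp' f g fg h).inv.toNatTrans.app A) w hw = 𝟙 _ := by
  subst h
  rw [Pseudofunctor.mapComp'_eq_mapComp]
  rfl

theorem pullHom_fam {U₁ U₂ Y Y' : Opens X} {A₁ : Atlas o U₁} {A₂ : Atlas o U₂} {f₁ : Y ⟶ U₁}
    {f₂ : Y ⟶ U₂} (φ : ((prestack o).map f₁.op.toLoc).toFunctor.obj A₁ ⟶
      ((prestack o).map f₂.op.toLoc).toFunctor.obj A₂) (g : Y' ⟶ Y) (gf₁ : Y' ⟶ U₁) (gf₂ : Y' ⟶ U₂)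
    (hgf₁ : g ≫ f₁ = gf₁) (hgf₂ : g ≫ f₂ = gf₂) (w : X) (hw : w ∈ Y') :
    Atlas.Hom.fam (pullHom (F := (prestack o).toPseudofunctor) (M₁ := A₁) (M₂ := A₂) φ g gf₁ gf₂
      hgf₁ hgf₂) w hw = Atlas.Hom.fam φ w (leOfHom g hw) := by
  refine (congrArg₂ (· ≫ ·) (mapComp'_hom_fam _ _ _ _ _ _ _) (congrArg₂ (· ≫ ·) rfl
    (mapComp'_inv_fam _ _ _ _ _ _ _))).trans ?_
  refine (Category.id_comp _).trans (Category.comp_id _)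

/-- The comparison isomorphisms of this prestack have identity components, so descent data amount to
pointwise gluing data, covered by `Atlas.hom_glue` and `Atlas.obj_glue`. -/
theorem isEquivalence_toDescentData {ι : Type*} {V : ι → Opens X} (f : ∀ k, V k ⟶ U)
    (cover : ∀ p ∈ U, ∃ k, p ∈ V k) :
    ((prestack o).toPseudofunctor.toDescentData f).IsEquivalence where
  faithful := ⟨fun {A B φ ψ} h => by
    refine Atlas.hom_ext fun w hw => ?_
    obtain ⟨k, hk⟩ := cover w hw
    exact congrArg (fun t => Atlas.Hom.fam (Pseudofunctor.DescentData.Hom.hom t k) w hk) h⟩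
  full := ⟨fun {A B} φ => by
    obtain ⟨ψ, hψ⟩ := Atlas.hom_glue (fun k => leOfHom (f k)) cover A B (fun k => φ.hom k)
      fun k l w hk hl => by
        have e := congrArg (fun t => Atlas.Hom.fam (U := V k ⊓ V l) t w ⟨hk, hl⟩)
          (φ.comm (homOfLE (inf_le_left.trans (leOfHom (f k)))) (homOfLE inf_le_left)
            (homOfLE (inf_le_right : V k ⊓ V l ≤ V l)) rfl rfl)
        have e' (D : Atlas o U) (i) (j) : Atlas.Hom.fam
          ((Pseudofunctor.DescentData.ofObj (F := (prestack o).toPseudofunctor) (f := f) D).hom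
            (homOfLE (inf_le_left.trans (leOfHom (f k)))) (homOfLE inf_le_left)
            (homOfLE (inf_le_right : V k ⊓ V l ≤ V l)) i j) w ⟨hk, hl⟩ = 𝟙 _ :=
          (congrArg₂ (· ≫ ·) (mapComp'_inv_fam _ _ _ _ _ _ _)
            (mapComp'_hom_fam _ _ _ _ _ _ _)).trans (Category.comp_id _)
        exact ((Category.comp_id _).symm.trans ((congrArg (_ ≫ ·)
          (e' B rfl rfl).symm).trans e)).trans
          ((congrArg (· ≫ _) (e' A rfl rfl)).trans (Category.id_comp _))
    exact ⟨ψ, Pseudofunctor.DescentData.hom_ext hψ⟩⟩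
  essSurj := ⟨fun D => by
    let t {Y : Opens X} {k l : ι} (hk : Y ≤ V k) (hl : Y ≤ V l) :=
      D.hom (homOfLE (hk.trans (leOfHom (f k)))) (homOfLE hk) (homOfLE hl) rfl
        (Subsingleton.elim _ _)
    -- At a point, the transition over any `Y` has the same value as the one over `V k ⊓ V l`, so
    -- the latter carries the whole datum.
    have h {Y : Opens X} {k l : ι} (hk : Y ≤ V k) (hl : Y ≤ V l) (w : X) (hw : w ∈ Y) :
        Atlas.Hom.fam (U := V k ⊓ V l) (t inf_le_left inf_le_right) w ⟨hk hw, hl hw⟩ =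
        Atlas.Hom.fam (U := Y) (t hk hl) w hw :=
      ((congrArg (fun s => Atlas.Hom.fam (U := Y) s w hw)
        (D.pullHom_hom (homOfLE (le_inf hk hl)) _ _ rfl _ _ rfl (Subsingleton.elim _ _) (homOfLE hk)
          (homOfLE hl) rfl rfl)).symm.trans (pullHom_fam _ _ _ _ _ _ _ _)).symm
    obtain ⟨B, e, he⟩ := Atlas.obj_glue (fun k => leOfHom (f k)) cover D.obj
      (fun k l => t inf_le_left inf_le_right)
      (fun k l m w hk hl hm => by
        have hk' : V k ⊓ V l ⊓ V m ≤ V k := inf_le_left.trans inf_le_left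
        have hl' : V k ⊓ V l ⊓ V m ≤ V l := inf_le_left.trans inf_le_right
        have hm' : V k ⊓ V l ⊓ V m ≤ V m := inf_le_right
        have hw : w ∈ V k ⊓ V l ⊓ V m := ⟨⟨hk, hl⟩, hm⟩
        rw [h hk' hl' w hw, h hl' hm' w hw, h hk' hm' w hw]
        exact congrArg (fun t => Atlas.Hom.fam (U := V k ⊓ V l ⊓ V m) t w hw)
          (D.hom_comp (homOfLE (hk'.trans (leOfHom (f k)))) (homOfLE hk') (homOfLE hl')
            (homOfLE hm') rfl (Subsingleton.elim _ _) (Subsingleton.elim _ _)))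
    have (k : ι) : IsIso (C := Atlas o (V k)) (e k) := IsGroupoid.all_isIso _
    refine ⟨B, ⟨(Pseudofunctor.DescentData.isoMk
      (fun k => asIso (C := Atlas o (V k)) (e k)) ?_).symm⟩⟩
    intro Y q k l f₁ f₂ hf₁ hf₂
    refine Atlas.hom_ext fun w hw => ?_
    refine ((congrArg (_ ≫ ·) ?_).trans (Category.comp_id _)).trans
      ((he k l w (leOfHom f₁ hw) (leOfHom f₂ hw)).symm.trans (congrArg (· ≫ _) ?_))
    · exact (congrArg₂ (· ≫ ·) (mapComp'_inv_fam _ _ _ _ _ _ _)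
            (mapComp'_hom_fam _ _ _ _ _ _ _)).trans (Category.comp_id _)
    · exact h (leOfHom f₁) (leOfHom f₂) w hw⟩

theorem isStack_prestack : (prestack o).toPseudofunctor.IsStack (Opens.grothendieckTopology X) :=
  Pseudofunctor.IsStack.of_isStackFor fun U R hR => ⟨isEquivalence_toDescentData _ fun p hp => by
    obtain ⟨V, f, hf, hV⟩ := hR p hp
    exact ⟨⟨Over.mk f, hf⟩, hV⟩⟩

end LocalGroupoid.Congruence

end GerbeExtension

/-! ### The quotient gerbe and the projection to it. -/

namespace GerbeExtension

namespace LocalGroupoid.Congruence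

variable {X : Type v} [TopologicalSpace X] {S : LocalGroupoid.{v, v, u} X} {c : S.Congruence}
  {o : ∀ z, c.Stalk z} {U V W : Opens X}

/-- The family of automorphisms corresponding to a local morphism between the objects of two
charts. -/
noncomputable def family (α β : Chart o) (hα : W ≤ α.dom) (hβ : W ≤ β.dom)
    (f : S.pt (hα.trans α.le) α.obj ⟶ S.pt (hβ.trans β.le) β.obj) : Family o W :=
  fun w hw => CategoryTheory.inv (α.triv w (hα hw)) ≫ germ hw f ≫ β.triv w (hβ hw)

theorem isCont_family (α β : Chart o) (hα : W ≤ α.dom) (hβ : W ≤ β.dom)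
    (f : S.pt (hα.trans α.le) α.obj ⟶ S.pt (hβ.trans β.le) β.obj) {z : X} (hz : z ∈ W) :
    IsCont α β (family α β hα hβ f) z :=
  ⟨W, hα, hβ, le_rfl, f, hz, fun w hw => by rw [family, IsIso.hom_inv_id_assoc]⟩

namespace Atlas

/-- Continuity of a family of automorphisms can be tested on suitable charts. -/
def homMk {A B : Atlas o U} (φ : Family o U) (h : ∀ z ∈ U, ∃ α ∈ A.charts, ∃ β ∈ B.charts,
    z ∈ α.dom ∧ z ∈ β.dom ∧ IsCont α β φ z) : A ⟶ B where
  fam := φ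
  cont α' hα' β' hβ' z hz hzα' hzβ' := by
    obtain ⟨α, hα, β, hβ, hzα, hzβ, e⟩ := h z hz
    refine (((A.compat α' hα' α hα z hz hzα' hzα).comp e).comp
      (B.compat β hβ β' hβ' z hz hzβ hzβ')).congr hz le_rfl le_rfl fun w hw => ?_
    simp only [Category.id_comp, Category.comp_id]

/-- At `p` both atlases are trivialized against the same `o p`. The resulting isomorphism of germs
is represented by a morphism near `p`, which defines a continuous family there. -/
theorem exists_hom (A B : Atlas o U) {p : X}
    (hp : p ∈ U) : ∃ (V : Opens X) (h : V ≤ U), p ∈ V ∧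
      Nonempty ((res h).obj A ⟶ (res h).obj B) := by
  obtain ⟨α, hα, hpα⟩ := A.cover p hp
  obtain ⟨β, hβ, hpβ⟩ := B.cover p hp
  obtain ⟨W, hW, hWα, hWβ, f, -⟩ := exists_germ (c := c)
    (α.triv p hpα ≫ CategoryTheory.inv (β.triv p hpβ))
  have hα' : W ⊓ (α.dom ⊓ β.dom ⊓ U) ≤ α.dom := inf_le_right.trans (inf_le_left.trans inf_le_left)
  have hβ' : W ⊓ (α.dom ⊓ β.dom ⊓ U) ≤ β.dom := inf_le_right.trans (inf_le_left.trans inf_le_right)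
  exact ⟨W ⊓ (α.dom ⊓ β.dom ⊓ U), inf_le_right.trans inf_le_right, ⟨hW, ⟨hpα, hpβ⟩, hp⟩,
    ⟨homMk (family α β hα' hβ' (S.rst inf_le_left f)) fun z hz =>
      ⟨α, hα, β, hβ, hα' hz, hβ' hz, isCont_family _ _ _ _ _ hz⟩⟩⟩

end Atlas

/-- The chosen trivialization of a germ of an object. -/
noncomputable def triv (ho : ∀ z (x : c.Stalk z), Nonempty (x ⟶ o z)) (x : S.Ob U) (z : X)
    (hz : z ∈ U) : c.st hz x ⟶ o z := (ho z (c.st hz x)).some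

/-- The chart of a local object. -/
noncomputable def chart (ho : ∀ z (x : c.Stalk z), Nonempty (x ⟶ o z)) (x : S.Ob U) : Chart o where
  dom := U
  obDom := U
  le := le_rfl
  obj := x
  triv := triv ho x

/-- The atlas of a local object. -/
noncomputable def atlas (ho : ∀ z (x : c.Stalk z), Nonempty (x ⟶ o z)) (x : S.Ob U) :
    Atlas o U where
  charts := {chart ho x}
  cover _ hz := ⟨chart ho x, rfl, hz⟩
  compat := by
    rintro _ rfl _ rfl z hz hzα -
    exact IsCont.one _ hzα hz

/-- The morphism of atlases induced by a local morphism. -/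
noncomputable def atlasMap (ho : ∀ z (x : c.Stalk z), Nonempty (x ⟶ o z)) {hU : W ≤ U} {hV : W ≤ V}
    {x : S.Ob U} {y : S.Ob V} (f : S.pt hU x ⟶ S.pt hV y) :
    (Atlas.res hU).obj (atlas ho x) ⟶ (Atlas.res hV).obj (atlas ho y) :=
  Atlas.homMk (fun w hw => CategoryTheory.inv (triv ho x w (hU hw)) ≫ germ hw f ≫
    triv ho y w (hV hw)) fun _ hz => ⟨chart ho x, rfl, chart ho y, rfl, hU hz, hV hz,
      isCont_family (chart ho x) (chart ho y) hU hV f hz⟩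

theorem atlasMap_fam (ho : ∀ z (x : c.Stalk z), Nonempty (x ⟶ o z)) {hU : W ≤ U} {hV : W ≤ V}
    {x : S.Ob U} {y : S.Ob V} (f : S.pt hU x ⟶ S.pt hV y) (w : X) (hw : w ∈ W) :
    (atlasMap ho f).fam w hw = CategoryTheory.inv (triv ho x w (hU hw)) ≫ germ hw f ≫
      triv ho y w (hV hw) := rfl

theorem atlasMap_id (ho : ∀ z (x : c.Stalk z), Nonempty (x ⟶ o z)) (hU : W ≤ U) (x : S.Ob U) :
    atlasMap ho (𝟙 (S.pt hU x)) = 𝟙 _ := by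
  ext w hw
  rw [atlasMap_fam, germ_id hw, Category.id_comp, IsIso.inv_hom_id, Atlas.id_fam]

theorem atlasMap_comp (ho : ∀ z (x : c.Stalk z), Nonempty (x ⟶ o z)) {Y : Opens X} {hU : W ≤ U}
    {hV : W ≤ V} {hY : W ≤ Y} {x : S.Ob U} {y : S.Ob V} {t : S.Ob Y} (f : S.pt hU x ⟶ S.pt hV y)
    (g : S.pt hV y ⟶ S.pt hY t) : atlasMap ho (f ≫ g) = atlasMap ho f ≫ atlasMap ho g := by
  ext w hw
  simp only [atlasMap_fam, germ_comp hw, Atlas.comp_fam, Category.assoc, IsIso.hom_inv_id_assoc]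

theorem atlasMap_eq_iff (ho : ∀ z (x : c.Stalk z), Nonempty (x ⟶ o z)) {hU : W ≤ U}
    {hV : W ≤ V} {x : S.Ob U} {y : S.Ob V} (f g : S.pt hU x ⟶ S.pt hV y) :
    atlasMap ho f = atlasMap ho g ↔ c.r f g := by
  refine ⟨fun h => r_of_germ_eq fun w hw => ?_, fun h => Atlas.hom_ext fun w hw => ?_⟩
  · have e := congrArg (fun t => Atlas.Hom.fam t w hw) h
    simp only [atlasMap_fam] at e
    exact (cancel_mono _).1 ((cancel_epi _).1 e)
  · rw [atlasMap_fam, atlasMap_fam, germ_eq_of_r h hw]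

/-- The gerbe of atlases. -/
noncomputable def quotient (ho : ∀ z (x : c.Stalk z), Nonempty (x ⟶ o z)) :
    Gerbe.{v, v, max u v} X where
  toPrestack := prestack o
  isStack := isStack_prestack
  isGroupoid U := inferInstanceAs (IsGroupoid (Atlas o U))
  locally_nonempty z := ⟨(o z).dom, (o z).mem, ⟨atlas ho (o z).obj⟩⟩
  locally_connected _ i j _ hp := Atlas.exists_hom i j hp

variable (ho : ∀ z (x : c.Stalk z), Nonempty (x ⟶ o z))

theorem rst_fam {W' : Opens X} (k : W' ≤ W) {hU : W ≤ U} {hV : W ≤ V}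
    {A : Atlas o U} {B : Atlas o V} (f : (Atlas.res hU).obj A ⟶ (Atlas.res hV).obj B) (w : X)
    (hw : w ∈ W') :
    Atlas.Hom.fam (U := W') ((quotient ho).strict.rst (hU := hU) (hV := hV) (x := A) (y := B) k f)
      w hw = f.fam w (k hw) :=
  pullHom_fam (A₁ := A) (A₂ := B) f (homOfLE k) _ _ rfl rfl w hw

end LocalGroupoid.Congruence

namespace LocalGroupoid.Congruence

variable {X : Type v} [TopologicalSpace X] {S : LocalGroupoid.{v, v, max u v} X} {c : S.Congruence}
  {o : ∀ z, c.Stalk z} (ho : ∀ z (x : c.Stalk z), Nonempty (x ⟶ o z)) {U V W : Opens X}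

/-- The projection to the quotient. -/
noncomputable def proj : LocalGroupoid.Hom S (quotient ho).strict where
  obj x := atlas ho x
  map f := atlasMap ho f
  map_id hU x := atlasMap_id ho hU x
  map_comp f g := atlasMap_comp ho f g
  map_rst k _ _ _ _ f := Atlas.hom_ext fun w hw => by
    refine Eq.trans ?_ (rst_fam ho k _ w hw).symm
    rw [atlasMap_fam, atlasMap_fam, germ_rst]

/-- An atlas is locally isomorphic to the atlas of the object in one of its charts, and continuity
says precisely that a family comes locally from a morphism of `S`. As the object of a chart may live
on a larger open set, `hS` replaces it by one on the required domain. -/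
theorem isWeakEpi_proj (hS : ∀ {U V : Opens X} (h : V ≤ U) (x : S.Ob U),
    ∃ x' : S.Ob V, Nonempty (S.pt le_rfl x' ⟶ S.pt h x)) : (proj ho).IsWeakEpi where
  exists_obj {U} q p hp := by
    obtain ⟨α, hα, hpα⟩ := Atlas.cover q p hp
    have hV : α.dom ⊓ U ≤ α.dom := inf_le_left
    obtain ⟨i, ⟨f⟩⟩ := hS (hV.trans α.le) α.obj
    exact ⟨α.dom ⊓ U, inf_le_right, i, ⟨hpα, hp⟩,
      ⟨Atlas.homMk (U := α.dom ⊓ U) (A := (Atlas.res le_rfl).obj (atlas ho i))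
        (B := (Atlas.res inf_le_right).obj q) (family (chart ho i) α le_rfl hV f) fun z hz =>
        ⟨chart ho i, rfl, α, hα, hz, hV hz, isCont_family _ _ _ _ _ hz⟩⟩⟩
  exists_map {W U V hU hV x y} f p hp := by
    obtain ⟨W', hWU, hWV, hW, g, hp', e⟩ := Atlas.Hom.cont f (chart ho x) rfl (chart ho y) rfl p hp
      (hU hp) (hV hp)
    refine ⟨W', hW, g, hp', Atlas.hom_ext fun w hw => ?_⟩
    refine Eq.trans ?_ (rst_fam ho hW f w hw).symm
    exact (IsIso.inv_comp_eq _).2 (e w hw)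

end LocalGroupoid.Congruence

end GerbeExtension

/-! ### Return to gerbes: the extension and its universal property. -/

namespace GerbeExtension

open LocalGroupoid

variable {X : Type v} [TopologicalSpace X]

theorem IsWeakEpi.of_strict {G H : Gerbe.{v, v, u} X} {F : GerbeHom G H}
    (hF : F.strict.IsWeakEpi) : IsWeakEpi F where
  locally_surj_obj U q p hp := by
    obtain ⟨V, h, i, hp', ⟨e⟩⟩ := hF.exists_obj q p hp
    exact ⟨V, h, i, hp', ⟨(H.unitor _).symm ≪≫ asIso e⟩⟩
  surj_iso U i j f p hp := by
    obtain ⟨W, h, g, hp', e⟩ := hF.exists_map (hU := le_rfl) (hV := le_rfl) ((H.res le_rfl).map f)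
      p hp
    refine ⟨W, h, g, hp', ?_⟩
    rw [← F.strict_map_comp_psi]
    exact congrArg (F.psi h i ≫ ·) (e.trans (H.rst_map h le_rfl f))

theorem IsExtension.of_strict {G H : Gerbe.{v, v, u} X} {N : NormalSubgroupoid G} {F : GerbeHom G H}
    (hF : F.strict.IsWeakEpi) (hN : ∀ {W U V : Opens X} {hU : W ≤ U} {hV : W ≤ V} {x : G.Sec U}
      {y : G.Sec V} (f g : (G.res hU).obj x ⟶ (G.res hV).obj y),
      F.strict.map (hU := hU) (hV := hV) f = F.strict.map (hU := hU) (hV := hV) g ↔ N.Rel f g) :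
    IsExtension N F where
  isWeakEpi := .of_strict hF
  eq_kernel U := by
    have key {i : G.Sec U} (f : i ⟶ i) :
        f ∈ (N.on U).arrows i i ↔ f ∈ (kernel (F.on U)).arrows i i := by
      have e : f = (G.unitor i).inv ≫ (G.res le_rfl).map f ≫ (G.unitor i).hom := by
        rw [Iso.eq_inv_comp, G.unitor_naturality]
      have e' : (G.res le_rfl).map f = (G.unitor i).hom ≫ f ≫ (G.unitor i).inv := by
        rw [← Category.assoc, Iso.eq_comp_inv, G.unitor_naturality]
      have h : N.Rel f (𝟙 i) ↔ f ∈ (N.on U).arrows i i := by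
        simp [NormalSubgroupoid.Rel]
      -- Restriction along `le_rfl` is conjugation by `unitor`, under which the congruence is
      -- invariant.
      have h' : N.Rel ((G.res le_rfl).map f) ((G.res le_rfl).map (𝟙 i)) ↔ N.Rel f (𝟙 i) := by
        refine ⟨fun h => ?_, fun h => ?_⟩
        · have := ((N.rel_refl (G.unitor i).inv).comp h).comp (N.rel_refl (G.unitor i).hom)
          rw [CategoryTheory.Functor.map_id, Category.comp_id, Iso.inv_hom_id, Category.assoc,
            ← e] at this
          exact this
        · have := ((N.rel_refl (G.unitor i).hom).comp h).comp (N.rel_refl (G.unitor i).inv)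
          rw [Category.comp_id, Iso.hom_inv_id, Category.assoc, ← e'] at this
          rwa [CategoryTheory.Functor.map_id]
      rw [mem_kernel_iff, ← h, ← h', ← hN (hU := le_rfl) (hV := le_rfl), F.strict_map_map,
        F.strict_map_map, CategoryTheory.Functor.map_id]
      refine ⟨fun h => ?_, fun h => by rw [h]⟩
      have := congrArg H.unloc h
      rwa [H.unloc_map, H.unloc_map] at this
    ext i j f
    refine ⟨fun h => ?_, fun h => ?_⟩
    · obtain rfl := (N.isNormal U).totally_disconnected i j ⟨f, h⟩
      exact (key f).1 h
    · obtain ⟨rfl, -⟩ := id h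
      exact (key f).2 h

theorem PrestackHom.exists_extension {G H T : Gerbe.{v, v, max u v} X} {F : GerbeHom G H}
    (hF : IsWeakEpi F) (K : GerbeHom G T) (hK : ∀ {W : Opens X} {a b : G.Sec W} (f g : a ⟶ b),
      (F.on W).map f = (F.on W).map g → (K.on W).map f = (K.on W).map g) :
    ∃ E : GerbeHom H T, Nonempty (F ≫ E ≅ K) := by
  obtain ⟨E, ⟨η⟩⟩ := LocalGroupoid.exists_extension.{v, u} (K := K.strict) hF.strict
    T.isStack_strict (fun {_ _ _ _ _ _ _} f g h => (K.strict_map_eq_iff f g).2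
      (hK f g ((F.strict_map_eq_iff f g).1 h)))
  exact ⟨ofStrict E, (nonempty_iso_iff _ _).2 ⟨(strictComp F (ofStrict E)).trans
    ((Hom.Trans.whiskerLeft F.strict (strictOfStrict E)).trans η)⟩⟩

theorem PrestackHom.nonempty_iso_of_comp {G H T : Gerbe.{v, v, max u v} X} {F : GerbeHom G H}
    (hF : IsWeakEpi F) {E E' : GerbeHom H T} (e : F ≫ E ≅ F ≫ E') : Nonempty (E ≅ E') := by
  obtain ⟨η⟩ := (nonempty_iso_iff _ _).1 ⟨e⟩
  exact (nonempty_iso_iff _ _).2 (LocalGroupoid.exists_trans_of_comp.{v, u} hF.strict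
    T.isStack_strict ((strictComp F E).symm.trans (η.trans (strictComp F E'))))

/-- The congruence defined by a normal subgroupoid. -/
def NormalSubgroupoid.congruence {G : Gerbe.{v, v, u} X} (N : NormalSubgroupoid G) :
    G.strict.Congruence where
  r {W _ _ _ _ _ _} f g := N.Rel (W := W) f g
  refl f := N.rel_refl f
  symm h := h.symm
  trans h h' := h.trans h'
  comp h h' := h.comp h'
  rst k _ _ _ _ _ _ h := h.rst k
  of_rst h := N.rel_of_rst h

/-- Local connectedness of `G` becomes connectedness of the stalks, so one object per stalk can
serve as the common reference. -/
theorem Gerbe.exists_germ_hom {G : Gerbe.{v, v, u} X} (c : G.strict.Congruence) {z : X}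
    (x y : c.Stalk z) : Nonempty (x ⟶ y) := by
  obtain ⟨W, h, hz, ⟨f⟩⟩ := G.locally_connected (x.dom ⊓ y.dom) ((G.res inf_le_left).obj x.obj)
    ((G.res inf_le_right).obj y.obj) z ⟨x.mem, y.mem⟩
  exact ⟨Congruence.germ (S := G.strict) (hU := h.trans inf_le_left) (hV := h.trans inf_le_right) hz
    ((G.cart h inf_le_left x.obj).inv ≫ f ≫ (G.cart h inf_le_right y.obj).hom)⟩

theorem NormalSubgroupoid.exists_isExtension {G : Gerbe.{v, v, max u v} X}
    (N : NormalSubgroupoid G) :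
    ∃ (Q : Gerbe.{v, v, max u v} X) (F : GerbeHom G Q), IsExtension N F := by
  choose U hU x using G.locally_nonempty
  let o : ∀ z, N.congruence.Stalk z := fun z => ⟨U z, hU z, (x z).some⟩
  have ho : ∀ z (y : N.congruence.Stalk z), Nonempty (y ⟶ o z) := fun z y =>
    Gerbe.exists_germ_hom _ _ _
  have hE := Congruence.isWeakEpi_proj.{v, u} ho fun {U V} h i => ⟨(G.res h).obj i,
    ⟨(G.unitor ((G.res h).obj i)).hom⟩⟩
  refine ⟨Congruence.quotient ho, PrestackHom.ofStrict (Congruence.proj.{v, u} ho),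
    .of_strict ⟨hE.exists_obj, ?_⟩ ?_⟩
  · intro W U V hU hV x y f p hp
    obtain ⟨W', h, g, hp', e⟩ := hE.exists_map f p hp
    exact ⟨W', h, g, hp', (PrestackHom.strict_ofStrict_map _ g).trans e⟩
  · intro W U V hU hV x y f g
    rw [PrestackHom.strict_ofStrict_map, PrestackHom.strict_ofStrict_map]
    exact Congruence.atlasMap_eq_iff ho f g

end GerbeExtension

/-! ### Equivalences of extensions, and the theorem. -/

namespace GerbeExtension

namespace PrestackHom

variable {X : Type w} [TopologicalSpace X]

theorem map_eq_conj {G : Gerbe.{w, v, u} X} {F : GerbeHom G G}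
    (e : F ≅ 𝟙 G.toPrestack.toPseudofunctor) {U : Opens X} (i : G.Sec U) :
    ∃ p : (F.on U).obj i ≅ i, ∀ a : i ⟶ i, (F.on U).map a ≫ p.hom = p.hom ≫ a := by
  let t : F.on U ⟶ 𝟭 (G.Sec U) := (e.hom.as.app (.mk (op U))).toNatTrans
  exact ⟨asIso (t.app i), fun a => t.naturality a⟩

/-- For `a` in `N'`, the conjugate `D(K(a))` of `a` lies in `N'`, hence equals `D(b)` with `b` in
`N`. As `D ≫ K` is isomorphic to the identity, `D` is faithful, so `K(a) = b`. -/
theorem mapsInto_of_inducesIso {G G' : Gerbe.{w, v, u} X} {N : NormalSubgroupoid G}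
    {N' : NormalSubgroupoid G'} {D : GerbeHom G G'} {K : GerbeHom G' G}
    (e : D ≫ K ≅ 𝟙 G.toPrestack.toPseudofunctor) (e' : K ≫ D ≅ 𝟙 G'.toPrestack.toPseudofunctor)
    (hD : InducesIso D N N') : MapsInto K N' N := by
  intro U j a ha
  obtain ⟨p, hp⟩ := map_eq_conj e' j
  obtain ⟨q, hq⟩ := map_eq_conj e ((K.on U).obj j)
  have h := NormalSubgroupoid.conj_mem p.hom ha
  rw [← Category.assoc, ← hp, Category.assoc, IsIso.hom_inv_id, Category.comp_id] at h
  obtain ⟨b, hb, hab⟩ := (hD U ((K.on U).obj j)).surjOn h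
  have hb' := congrArg (K.on U).map hab
  have e₁ := (hq b).symm.trans ((congrArg (· ≫ q.hom) hb').trans (hq ((K.on U).map a)))
  rw [cancel_epi] at e₁
  rwa [← e₁]

end PrestackHom

theorem IsMorphismOfExtensions.isEquivalence {X : Type v} [TopologicalSpace X]
    {G H G' H' : Gerbe.{v, v, max u v} X} {N : NormalSubgroupoid G} {F : GerbeHom G H}
    {N' : NormalSubgroupoid G'} {F' : GerbeHom G' H'} {D : GerbeHom G G'} {E : GerbeHom H H'}
    (hE : IsMorphismOfExtensions N F N' F' D E) (hD : D.IsEquivalence) (hN : InducesIso D N N') :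
    E.IsEquivalence := by
  obtain ⟨K, ⟨i⟩, ⟨j⟩⟩ := hD
  obtain ⟨r⟩ := hE.right_square
  have hK := PrestackHom.mapsInto_of_inducesIso i j hN
  -- The candidate inverse is the extension of `K ≫ F` along `F'`. It exists because `K` maps `N'`,
  -- the kernel of `F'`, into `N`, the kernel of `F`.
  obtain ⟨E', ⟨s⟩⟩ := PrestackHom.exists_extension.{v, u} hE.target.isWeakEpi
    (K ≫ F : GerbeHom G' H) (fun {W a b} f g h =>
      (hE.source.rel_iff _ _).1 (((hE.target.rel_iff f g).2 h).map hK))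
  refine ⟨E', PrestackHom.nonempty_iso_of_comp.{v, u} hE.source.isWeakEpi ?_,
    PrestackHom.nonempty_iso_of_comp.{v, u} hE.target.isWeakEpi ?_⟩
  -- Chain: `F E E' ≅ D F' E' ≅ D K F ≅ F`; the next goal is symmetric, with `F' E' E ≅ K F E ≅ K D
  -- F' ≅ F'`.
  · exact (α_ _ _ _).symm ≪≫ whiskerRightIso r E' ≪≫ α_ _ _ _ ≪≫ whiskerLeftIso D s ≪≫
      (α_ _ _ _).symm ≪≫ whiskerRightIso i F ≪≫ λ_ F ≪≫ (ρ_ F).symm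
  · exact (α_ _ _ _).symm ≪≫ whiskerRightIso s E ≪≫ α_ _ _ _ ≪≫ whiskerLeftIso K r ≪≫
      (α_ _ _ _).symm ≪≫ whiskerRightIso j F' ≪≫ λ_ F' ≪≫ (ρ_ F').symm

end GerbeExtension

theorem mainTheorem4 {X : Type v} [TopologicalSpace X]
    (G : GerbeExtension.Gerbe.{v, v, max u v} X) (N : GerbeExtension.NormalSubgroupoid G) :
    ∃ (Q : GerbeExtension.Gerbe.{v, v, max u v} X) (F : GerbeExtension.GerbeHom G Q),
      GerbeExtension.IsExtension N F ∧
      (∀ (G' H' : GerbeExtension.Gerbe.{v, v, max u v} X)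
        (N' : GerbeExtension.NormalSubgroupoid G') (F' : GerbeExtension.GerbeHom G' H')
        (D : GerbeExtension.GerbeHom G G'),
        GerbeExtension.IsExtension N' F' → GerbeExtension.MapsInto D N N' →
        (∃ E : GerbeExtension.GerbeHom Q H',
          GerbeExtension.IsMorphismOfExtensions N F N' F' D E ∧
          ∀ E' : GerbeExtension.GerbeHom Q H',
            GerbeExtension.IsMorphismOfExtensions N F N' F' D E' → Nonempty (E' ≅ E)) ∧
        (D.IsEquivalence → GerbeExtension.InducesIso D N N' →
          ∀ E : GerbeExtension.GerbeHom Q H',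
            GerbeExtension.IsMorphismOfExtensions N F N' F' D E → E.IsEquivalence)) := by
  obtain ⟨Q, F, hF⟩ := N.exists_isExtension
  refine ⟨Q, F, hF, fun G' H' N' F' D hF' hD => ⟨?_, fun h h' E hE => hE.isEquivalence h h'⟩⟩
  obtain ⟨E, ⟨e⟩⟩ := GerbeExtension.PrestackHom.exists_extension.{v, u} hF.isWeakEpi
    (D ≫ F' : GerbeExtension.GerbeHom G H')
    -- Morphisms identified by `F` differ by `N`, so their images under `D` differ by `N'`, the
    -- kernel of `F'`.
    (fun {W a b} f g h => (hF'.rel_iff _ _).1 (((hF.rel_iff f g).2 h).map hD))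
  refine ⟨E, ⟨hF, hF', hD, ⟨e⟩⟩, fun E' hE' => ?_⟩
  obtain ⟨e'⟩ := hE'.right_square
  exact GerbeExtension.PrestackHom.nonempty_iso_of_comp.{v, u} hF.isWeakEpi (e' ≪≫ e.symm)
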